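/- For $k,n\ge 1$ let $K_k^n$ be the complete $k$-partite graph with partite sets $V_1,\dots,V_k$, where $V_i=\{v_i^1,\dots,v_i^n\}$. A subgraph $J$ of a graph $G$ is $H$-saturated if $J$ contains no copy of $H$, but for every edge $e\in E(G)\setminus E(J)$ the graph $J+e$ contains a copy of $H$; $\operatorname{sat}(H,G)$ is the minimum number of edges of an $H$-saturated subgraph of $G$. For $k\ge 3$ let $G_1$ and $G_2$ be the spanning subgraphs of $K_k^n$ with \[E(G_1)=\{v_m^1v_i^j: 1\le m\le 2,\ 3\le i\le k,\ 1\le j\le n\}\cup\{v_1^iv_2^j: 1\le i,j\le n,\ i+j\ge 3\},\] \[E(G_2)=\{v_m^1v_i^j: 1\le m\le 3,\ 4\le i\le k,\ 1\le j\le n\}\cup\{v_m^1v_i^j: 1\le m,i\le 3,\ m\ne i,\ 2\le j\le n\}.\] Theorem. If $k\ge 3$ and $n\ge 100$, then \[\operatorname{sat}(K_3,K_k^n)=\min\{2kn+n^2-4n-1,\ 3kn-3n-6\}.\] Moreover, the $K_3$-saturated subgraphs of $K_k^n$ with this minimum number of edges are, up to automorphisms of $K_k^n$, exactly the following: $G_1$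 if $2kn+n^2-4n-1\le 3kn-3n-6$, and $G_2$ if $3kn-3n-6\le 2kn+n^2-4n-1$. -/

import Mathlib

/-- `J` is an `H`-saturated (spanning) subgraph of `G`: `J` contains no copy of `H`, but adding to
`J` any edge of `G` that is not in `J` creates a copy of `H`. -/
def IsSaturatedIn {W V : Type*} (H : SimpleGraph W) (G J : SimpleGraph V) : Prop :=
  J ≤ G ∧ H.Free J ∧
    ∀ e ∈ G.edgeSet \ J.edgeSet, H.IsContained (J ⊔ SimpleGraph.fromEdgeSet {e})

/-- `sat(H, G)`: the minimum number of edges of an `H`-saturated subgraph of `G`. -/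
noncomputable def satNumber {W V : Type*} (H : SimpleGraph W) (G : SimpleGraph V) : ℕ :=
  sInf {m : ℕ | ∃ J : SimpleGraph V, IsSaturatedIn H G J ∧ J.edgeSet.ncard = m}

/-- The subgraphs `J` and `J'` of `G` agree up to relabelling: an automorphism of `G` carries `J`
onto `J'`. -/
def AgreeUpToAut {V : Type*} (G J J' : SimpleGraph V) : Prop :=
  ∃ φ : G ≃g G, ∀ u v, J'.Adj (φ u) (φ v) ↔ J.Adj u v

/-- The complete `k`-partite graph with partite sets of size `n`; the vertex `(i, j)` is the
`j`-th vertex of the `i`-th partite set (counting from `0`). -/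
abbrev balancedMultipartite (k n : ℕ) : SimpleGraph (Fin k × Fin n) :=
  SimpleGraph.completeEquipartiteGraph k n

/-- The graph `G₁`: the vertices `(0, 0)` and `(1, 0)` are joined to all vertices outside the first
two partite sets, and the first two partite sets are completely joined except for the edge between
`(0, 0)` and `(1, 0)`. -/
def graphG1 (k n : ℕ) : SimpleGraph (Fin k × Fin n) :=
  SimpleGraph.fromRel fun u v =>
    (u.1.val < 2 ∧ u.2.val = 0 ∧ 2 ≤ v.1.val) ∨
    (u.1.val = 0 ∧ v.1.val = 1 ∧ 1 ≤ u.2.val + v.2.val)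

/-- The graph `G₂`: each of `(0, 0)`, `(1, 0)`, `(2, 0)` is joined to all vertices outside the first
three partite sets, and to all vertices other than these three in the two other ones of the first
three partite sets. -/
def graphG2 (k n : ℕ) : SimpleGraph (Fin k × Fin n) :=
  SimpleGraph.fromRel fun u v =>
    (u.1.val < 3 ∧ u.2.val = 0 ∧ 3 ≤ v.1.val) ∨
    (u.1.val < 3 ∧ u.2.val = 0 ∧ v.1.val < 3 ∧ v.1 ≠ u.1 ∧ 1 ≤ v.2.val)

/-! A spanning subgraph `J` of the complete multipartite graph is `K₃`-saturated exactly if it has no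
triangle and any two non-adjacent vertices of different parts have a common neighbour
(`PartiteSaturated`). So the neighbourhood of a vertex dominates everything outside the part of that
vertex, and all degrees are at least two.

The lower bound comes from discharging. Edges at a small core of hubs are charged in full to their
other ends, some further vertices, the givers, leave their edges to selected receivers, and all
other edges are split evenly (`charge`, with values doubled throughout). Let `v` be a vertex of
minimum degree. Degree at least six is immediate.

If `v` has degree two, with neighbours `a` and `b`, the vertices that are adjacent to neither of
them lie in the part of `v`. If there are none, then `N(a) \ N(b)` and `N(b) \ N(a)` are completely
joined across parts, and the count gives the first bound, with equality only for `graphG1`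
(`PartiteSaturated.ncard_of_dominated`). If there is just one, `c`, then `a`, `b`, `c` act as the
three hubs of `graphG2` and the count gives the second bound, with equality only for `graphG2`
(`PartiteSaturated.ncard_of_unique_missed`). If there are two or more, then degree two occurs only
in the part of `v` (`PartiteSaturated.three_le_card_nbr`).

In this last case, and if the minimum degree is three, four or five, the second bound holds strictly
(`PartiteSaturated.lt_ncard_of_three_le`). It allows each vertex outside the part of `v` a charge of
three and counts nothing for the part of `v`, whose charge, of order `n`, pays for a core of bounded
size. The core starts as `N(v)`. A deficient vertex `x` that sees only `a` in `N(v)` needs its other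
neighbours to reach the part of `a`. If that part has a deficient vertex, its few neighbours join the
core, and one of them is adjacent to `x`; if not, some neighbour of `x` is adjacent to many vertices
of that part and is a giver. Only vertices `x` of degree three with exactly one neighbour `q` outside
the core and the givers can remain. For a given set `K`, at most two vertices of an independent set
complete `K` to a neighbourhood (`PartiteSaturated.card_completers_inter_le_two`), so that few
vertices `q` occur, and they join the core as well; where the pair `K` contains a giver, that giver
keeps enough charge to pay for them. -/

section

open Finset

/-- The set of neighbours of `v` in `J`, as a `Finset`. -/
noncomputable def nbr {V : Type*} [Fintype V] (J : SimpleGraph V) (v : V) : Finset V :=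
  open scoped Classical in Finset.univ.filter fun w => J.Adj v w

/-- `J` is a `K₃`-saturated subgraph of the complete multipartite graph whose partite sets are the
fibres of `π`, in elementary terms. -/
structure PartiteSaturated {V ι : Type*} (J : SimpleGraph V) (π : V → ι) : Prop where
  part_ne : ∀ {u w}, J.Adj u w → π u ≠ π w
  no_triangle : ∀ {u v w}, J.Adj u v → J.Adj v w → ¬ J.Adj u w
  common : ∀ {u w}, π u ≠ π w → ¬ J.Adj u w → ∃ z, J.Adj u z ∧ J.Adj w z

@[simp] lemma mem_nbr {V : Type*} [Fintype V] {J : SimpleGraph V} {v w : V} :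
    w ∈ nbr J v ↔ J.Adj v w := by
  simp [nbr]

/-! ### Charging edges to vertices -/

section Counting

variable {V : Type*} [Fintype V] [DecidableEq V] {J : SimpleGraph V}

lemma sum_card_nbr {V : Type*} [Fintype V] {J : SimpleGraph V} :
    ∑ v, #(nbr J v) = 2 * J.edgeSet.ncard := by
  classical
  have h := J.sum_degrees_eq_twice_card_edges
  rw [Set.ncard_eq_toFinset_card', Set.toFinset_card, ← SimpleGraph.edgeFinset_card, ← h]
  refine Finset.sum_congr rfl fun v _ => ?_
  rw [← SimpleGraph.card_neighborFinset_eq_degree]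
  congr 1
  ext w
  simp

lemma sum_card_nbr_inter (S T : Finset V) :
    ∑ s ∈ S, #(nbr J s ∩ T) = ∑ t ∈ T, #(nbr J t ∩ S) := by
  classical
  have h := Finset.sum_card_bipartiteAbove_eq_sum_card_bipartiteBelow (s := S) (t := T) J.Adj
  convert h using 3 with s hs t ht
  · ext w; simp [Finset.bipartiteAbove, and_comm]
  · ext w; simp [Finset.bipartiteBelow, and_comm, J.adj_comm]

/-- The handshake lemma with the edges between `C` and its complement charged in full to the end
outside `C`. -/
lemma sum_card_nbr_compl (C : Finset V) :
    ∑ y ∈ Cᶜ, (#(nbr J y) + #(nbr J y ∩ C)) + ∑ c ∈ C, #(nbr J c ∩ C) =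
      2 * J.edgeSet.ncard := by
  rw [← sum_card_nbr, Finset.sum_add_distrib, sum_card_nbr_inter, ← Finset.sum_compl_add_sum C,
    add_assoc, ← Finset.sum_add_distrib]
  congr 1
  refine Finset.sum_congr rfl fun c _ => ?_
  rw [← Finset.card_union_of_disjoint, ← Finset.inter_union_distrib_left]
  · congr 1; ext; simp; tauto
  · exact Finset.disjoint_of_subset_left Finset.inter_subset_right
      (Finset.disjoint_of_subset_right Finset.inter_subset_right disjoint_compl_left)

/-- The charge received by `y`: edges from the core `C` count in full, edges between the givers `P`
and the receivers `Y` are charged to the receivers, and all other edges are split evenly between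
their ends. The values are doubled. -/
noncomputable def charge (J : SimpleGraph V) (C P Y : Finset V) (y : V) : ℤ :=
  #(nbr J y) + #(nbr J y ∩ C) + (if y ∈ Y then (#(nbr J y ∩ P) : ℤ) else 0) -
    (if y ∈ P then (#(nbr J y ∩ Y) : ℤ) else 0)

lemma sum_charge_le (C P Y : Finset V) (hP : Disjoint P C) (hY : Disjoint Y C) :
    ∑ y ∈ Cᶜ, charge J C P Y y ≤ 2 * (J.edgeSet.ncard : ℤ) := by
  have h1 := sum_card_nbr_compl (J := J) C
  have h2 := sum_card_nbr_inter (J := J) Y P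
  have hYC : Cᶜ ∩ Y = Y := Finset.inter_eq_right.2 fun y hy => by
    simpa using Finset.disjoint_left.1 hY hy
  have hPC : Cᶜ ∩ P = P := Finset.inter_eq_right.2 fun y hy => by
    simpa using Finset.disjoint_left.1 hP hy
  have e : ∑ y ∈ Cᶜ, charge J C P Y y = ∑ y ∈ Cᶜ, ((#(nbr J y) : ℤ) + #(nbr J y ∩ C)) := by
    unfold charge
    rw [Finset.sum_sub_distrib, Finset.sum_add_distrib, Finset.sum_ite_mem, Finset.sum_ite_mem,
      hYC, hPC]
    have : (∑ i ∈ Y, (#(nbr J i ∩ P) : ℤ)) = ∑ i ∈ P, (#(nbr J i ∩ Y) : ℤ) := by exact_mod_cast h2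
    rw [this]; ring
  rw [e]
  have : (∑ y ∈ Cᶜ, ((#(nbr J y) : ℤ) + #(nbr J y ∩ C))) ≤
      ((∑ y ∈ Cᶜ, (#(nbr J y) + #(nbr J y ∩ C)) + ∑ c ∈ C, #(nbr J c ∩ C) : ℕ) : ℤ) := by
    push_cast
    have : (0:ℤ) ≤ ∑ c ∈ C, (#(nbr J c ∩ C) : ℤ) := Finset.sum_nonneg fun _ _ => by positivity
    linarith
  rw [h1] at this
  exact_mod_cast this

/-- A giver keeps at least one unit, in doubled values, for each neighbour that is not a receiver. -/
lemma card_sdiff_le_charge {C P Y : Finset V} {y : V} : (#(nbr J y \ Y) : ℤ) ≤ charge J C P Y y := by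
  have h := Finset.card_sdiff_add_card_inter (nbr J y) Y
  unfold charge
  split_ifs <;> push_cast [← h] <;> linarith [(Nat.cast_nonneg (#(nbr J y ∩ C)) : (0:ℤ) ≤ _),
    (Nat.cast_nonneg (#(nbr J y ∩ P)) : (0:ℤ) ≤ _), (Nat.cast_nonneg (#(nbr J y ∩ Y)) : (0:ℤ) ≤ _)]

lemma charge_of_notMem {C P Y : Finset V} {y : V} (hP : y ∉ P) :
    (#(nbr J y) : ℤ) + #(nbr J y ∩ C) ≤ charge J C P Y y := by
  unfold charge
  rw [if_neg hP]
  split_ifs <;> linarith [(Nat.cast_nonneg (#(nbr J y ∩ P)) : (0:ℤ) ≤ _)]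

lemma charge_of_mem {C P Y : Finset V} {y : V} (hP : y ∉ P) (hY : y ∈ Y) :
    charge J C P Y y = (#(nbr J y) : ℤ) + #(nbr J y ∩ C) + #(nbr J y ∩ P) := by
  unfold charge
  rw [if_neg hP, if_pos hY, sub_zero]

end Counting

/-! ### Neighbourhoods dominate -/

/-- The neighbourhood of `v` dominates all vertices outside the part of `v`. -/
lemma PartiteSaturated.exists_nbr_adj {V ι : Type*} [Fintype V] {J : SimpleGraph V}
    {π : V → ι} (hJ : PartiteSaturated J π) {v y : V} (hy : π y ≠ π v)
    (hyD : y ∉ nbr J v) : ∃ a ∈ nbr J v, J.Adj y a := by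
  rw [mem_nbr] at hyD
  obtain ⟨z, h1, h2⟩ := hJ.common hy.symm hyD
  exact ⟨z, by simpa using h1, h2⟩

section Basic

variable {V ι : Type*} [Fintype V] [DecidableEq ι] {J : SimpleGraph V} {π : V → ι} {n : ℕ}

/-- The neighbours of a vertex of small degree do not lie in a single part: otherwise the rest of
that part could not be reached. -/
lemma PartiteSaturated.exists_nbr_part_ne (hJ : PartiteSaturated J π)
    (hn : ∀ i, #(univ.filter (π · = i)) = n) {v : V} (hv : #(nbr J v) < n) {j : ι} (hj : j ≠ π v) :
    ∃ a ∈ nbr J v, π a ≠ j := by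
  obtain ⟨w, hw, hwD⟩ := Finset.exists_mem_notMem_of_card_lt_card (hv.trans_eq (hn j).symm)
  simp only [mem_filter, mem_univ, true_and, mem_nbr] at hw hwD
  obtain ⟨z, hz1, hz2⟩ := hJ.common (by rw [hw]; exact hj.symm) hwD
  exact ⟨z, by simpa using hz1, fun h => hJ.part_ne hz2 (hw.trans h.symm)⟩

lemma PartiteSaturated.two_le_card_nbr (hJ : PartiteSaturated J π)
    (hn : ∀ i, #(univ.filter (π · = i)) = n) (h2 : 2 ≤ n) (hι : ∀ i : ι, ∃ j, j ≠ i) (v : V) :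
    2 ≤ #(nbr J v) := by
  by_contra! h
  obtain ⟨j, hj⟩ := hι (π v)
  obtain ⟨a, ha, -⟩ := hJ.exists_nbr_part_ne hn (h.trans_le h2) hj
  obtain ⟨b, hb, hab⟩ := hJ.exists_nbr_part_ne hn (h.trans_le h2)
    (hJ.part_ne (mem_nbr.1 ha)).symm
  rw [Finset.card_le_one.1 (Nat.lt_succ_iff.1 h) b hb a ha] at hab
  exact hab rfl

end Basic

/-! ### Completing a set to a neighbourhood -/

/-- The vertices that complete `K` to the neighbourhood of some vertex. -/
noncomputable def completers {V : Type*} [Fintype V] [DecidableEq V] (J : SimpleGraph V)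
    (K : Finset V) : Finset V :=
  open scoped Classical in univ.filter fun q => q ∉ K ∧ ∃ x, nbr J x = insert q K

section Completers

variable {V ι : Type*} [Fintype V] [DecidableEq V] {J : SimpleGraph V} {π : V → ι}

lemma mem_completers {K : Finset V} {q : V} :
    q ∈ completers J K ↔ q ∉ K ∧ ∃ x, nbr J x = insert q K := by
  simp [completers]

/-- As `K` does not reach `q₂`, a vertex with neighbourhood `K ∪ {q₁}` can only miss `q₂` if they
share a part. -/
lemma PartiteSaturated.part_eq_of_completers (hJ : PartiteSaturated J π) {K : Finset V}
    {q₁ q₂ x : V} (h₂ : q₂ ∈ completers J K) (hx : nbr J x = insert q₁ K)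
    (hne : q₁ ≠ q₂) (hadj : ¬ J.Adj q₁ q₂) : π q₂ = π x := by
  obtain ⟨hq₂, x₂, hx₂⟩ := mem_completers.1 h₂
  by_contra hπ
  have hnot : ¬ J.Adj x q₂ := by
    rw [← mem_nbr, hx, mem_insert]
    rintro (h | h)
    · exact hne h.symm
    · exact hq₂ h
  obtain ⟨z, hz₁, hz₂⟩ := hJ.common (Ne.symm hπ) hnot
  rw [← mem_nbr, hx, mem_insert] at hz₁
  rcases hz₁ with rfl | hz₁
  · exact hadj hz₂.symm
  · have h1 : J.Adj x₂ z := by rw [← mem_nbr, hx₂]; exact mem_insert_of_mem hz₁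
    have h2 : J.Adj x₂ q₂ := by rw [← mem_nbr, hx₂]; exact mem_insert_self _ _
    exact hJ.no_triangle h1 hz₂.symm h2

lemma PartiteSaturated.card_completers_inter_le_two (hJ : PartiteSaturated J π) (K : Finset V)
    {I : Finset V} (hI : ∀ u ∈ I, ∀ w ∈ I, ¬ J.Adj u w) : #(completers J K ∩ I) ≤ 2 := by
  by_contra! h
  obtain ⟨q₁, h1, q₂, h2, q₃, h3, h12, h13, h23⟩ := Finset.two_lt_card.1 h
  rw [mem_inter] at h1 h2 h3
  obtain ⟨-, x₁, hx₁⟩ := mem_completers.1 h1.1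
  obtain ⟨-, x₂, hx₂⟩ := mem_completers.1 h2.1
  have e1 := hJ.part_eq_of_completers h3.1 hx₁ h13 (hI _ h1.2 _ h3.2)
  have e2 := hJ.part_eq_of_completers h3.1 hx₂ h23 (hI _ h2.2 _ h3.2)
  have e3 := hJ.part_eq_of_completers h1.1 hx₂ h12.symm (hI _ h2.2 _ h1.2)
  have : J.Adj x₁ q₁ := by rw [← mem_nbr, hx₁]; exact mem_insert_self _ _
  exact hJ.part_ne this (by rw [e3, ← e2, e1])

lemma PartiteSaturated.card_completers_part_le_one [DecidableEq ι] (hJ : PartiteSaturated J π)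
    (K : Finset V) (i : ι) : #(completers J K ∩ univ.filter (π · = i)) ≤ 1 := by
  by_contra! h
  obtain ⟨q₁, h1, q₂, h2, h12⟩ := Finset.one_lt_card.1 h
  simp only [mem_inter, mem_filter, mem_univ, true_and] at h1 h2
  obtain ⟨-, x₁, hx₁⟩ := mem_completers.1 h1.1
  have e1 := hJ.part_eq_of_completers h2.1 hx₁ h12 fun h => hJ.part_ne h (h1.2.trans h2.2.symm)
  have : J.Adj x₁ q₁ := by rw [← mem_nbr, hx₁]; exact mem_insert_self _ _
  exact hJ.part_ne this (by rw [← e1, h1.2, h2.2])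

lemma PartiteSaturated.card_completers_sdiff_le [DecidableEq ι] (hJ : PartiteSaturated J π)
    (v : V) (K : Finset V) :
    #(completers J K \ nbr J v) ≤ 1 + 2 * #(nbr J v \ K) := by
  have hsub : completers J K \ nbr J v ⊆ (completers J K ∩ univ.filter (π · = π v)) ∪
      (nbr J v \ K).biUnion fun b => completers J K ∩ nbr J b := by
    intro q hq
    rw [mem_sdiff] at hq
    by_cases hπ : π q = π v
    · exact mem_union_left _ (by simp [hq.1, hπ])
    · obtain ⟨b, hb, hqb⟩ := hJ.exists_nbr_adj hπ hq.2
      refine mem_union_right _ (mem_biUnion.2 ⟨b, mem_sdiff.2 ⟨hb, fun hbK => ?_⟩,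
        mem_inter.2 ⟨hq.1, mem_nbr.2 hqb.symm⟩⟩)
      obtain ⟨-, x, hx⟩ := mem_completers.1 hq.1
      have h1 : J.Adj x q := by rw [← mem_nbr, hx]; exact mem_insert_self _ _
      have h2 : J.Adj x b := by rw [← mem_nbr, hx]; exact mem_insert_of_mem hbK
      exact hJ.no_triangle h1 hqb h2
  refine (card_le_card hsub).trans ((card_union_le _ _).trans
    (add_le_add (hJ.card_completers_part_le_one K _) ?_))
  refine card_biUnion_le.trans ((sum_le_card_nsmul _ _ 2 fun b _ => ?_).trans
    (by rw [smul_eq_mul, mul_comm]))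
  refine hJ.card_completers_inter_le_two K fun u hu w hw huw => ?_
  rw [mem_nbr] at hu hw
  exact hJ.no_triangle hu huw hw

end Completers

/-! ### Deficient vertices, cores and givers -/

section Defs

variable {V ι : Type*} [Fintype V] [DecidableEq V] [DecidableEq ι]

/-- The vertices outside `nbr J v` and the part of `v` whose doubled charge, with core `nbr J v` and
nothing given by other vertices, falls short of `6`. -/
noncomputable def deficient (J : SimpleGraph V) (π : V → ι) (v : V) : Finset V :=
  univ.filter fun y => π y ≠ π v ∧ y ∉ nbr J v ∧ #(nbr J y) + #(nbr J y ∩ nbr J v) ≤ 5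

/-- The neighbours of `v` whose part contains a deficient vertex. -/
noncomputable def weakHubs (J : SimpleGraph V) (π : V → ι) (v : V) : Finset V :=
  (nbr J v).filter fun a => ∃ u ∈ deficient J π v, π u = π a

/-- The part of `a` without the neighbours of `v`. -/
noncomputable def partRest (J : SimpleGraph V) (π : V → ι) (v a : V) : Finset V :=
  univ.filter fun w => π w = π a ∧ w ∉ nbr J v

/-- The vertices with at least six neighbours in a part, met by `nbr J v`, that has no deficient
vertices. They can leave all edges to deficient vertices to these, and the six neighbours alone still provide
a doubled charge of `6`. -/
noncomputable def givers (J : SimpleGraph V) (π : V → ι) (v : V) : Finset V :=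
  univ.filter fun p => p ∉ nbr J v ∧
    ∃ a ∈ nbr J v \ weakHubs J π v, 6 ≤ #(nbr J p ∩ partRest J π v a)

/-- The neighbourhood of `v`, enlarged by the neighbourhoods of one deficient vertex `u a` in the
part of each weak hub `a`, without the givers. -/
noncomputable def initialCore (J : SimpleGraph V) (π : V → ι) (v : V) (u : V → V) : Finset V :=
  nbr J v ∪ ((weakHubs J π v).biUnion fun a => nbr J (u a)) \ givers J π v

/-- The neighbours `a` of `v`, not weak hubs, such that `p` is adjacent to almost all of the part
of `a`. Seven exceptions are allowed: two vertices and the at most five neighbours of a vertex that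
is not a giver. -/
noncomputable def nearlyFull (J : SimpleGraph V) (π : V → ι) (v p : V) : Finset V :=
  (nbr J v \ weakHubs J π v).filter fun a =>
    #(partRest J π v a) ≤ #(nbr J p ∩ partRest J π v a) + 7

end Defs

section Charges

variable {V ι : Type*} [Fintype V] [DecidableEq V] [DecidableEq ι] {J : SimpleGraph V} {π : V → ι}
  {n : ℕ} {v : V} {u : V → V}

lemma mem_deficient {y : V} : y ∈ deficient J π v ↔
    π y ≠ π v ∧ y ∉ nbr J v ∧ #(nbr J y) + #(nbr J y ∩ nbr J v) ≤ 5 := by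
  simp [deficient]

lemma PartiteSaturated.one_le_of_deficient (hJ : PartiteSaturated J π) {y : V}
    (hy : y ∈ deficient J π v) : 1 ≤ #(nbr J y ∩ nbr J v) := by
  rw [mem_deficient] at hy
  obtain ⟨a, ha, hya⟩ := hJ.exists_nbr_adj hy.1 hy.2.1
  exact card_pos.2 ⟨a, mem_inter.2 ⟨mem_nbr.2 hya, ha⟩⟩

lemma disjoint_deficient_partRest {a : V} (ha : a ∈ nbr J v \ weakHubs J π v) :
    Disjoint (deficient J π v) (partRest J π v a) := by
  rw [Finset.disjoint_left]
  intro y hy hy'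
  simp only [partRest, mem_filter, mem_univ, true_and] at hy'
  rw [mem_sdiff, weakHubs, mem_filter] at ha
  exact ha.2 ⟨ha.1, y, hy, hy'.1⟩

lemma disjoint_deficient_givers : Disjoint (deficient J π v) (givers J π v) := by
  rw [Finset.disjoint_left]
  intro y hy hy'
  simp only [givers, mem_filter, mem_univ, true_and] at hy'
  obtain ⟨-, a, -, h⟩ := hy'
  have := card_le_card (inter_subset_left : nbr J y ∩ partRest J π v a ⊆ _)
  have := (mem_deficient.1 hy).2.2
  omega

lemma nbr_subset_initialCore : nbr J v ⊆ initialCore J π v u := subset_union_left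

lemma disjoint_givers_initialCore : Disjoint (givers J π v) (initialCore J π v u) := by
  rw [Finset.disjoint_left]
  intro p hp hp'
  rcases mem_union.1 hp' with h | h
  · simp only [givers, mem_filter] at hp
    exact hp.2.1 h
  · exact (mem_sdiff.1 h).2 hp

lemma nbr_subset_initialCore_union_givers {a : V} (ha : a ∈ weakHubs J π v) :
    nbr J (u a) ⊆ initialCore J π v u ∪ givers J π v := by
  intro p hp
  by_cases h : p ∈ givers J π v
  · exact mem_union_right _ h
  · exact mem_union_left _ (mem_union_right _ (mem_sdiff.2 ⟨mem_biUnion.2 ⟨a, ha, hp⟩, h⟩))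

lemma PartiteSaturated.card_nbr_sdiff_of_deficient (hJ : PartiteSaturated J π) {y : V}
    (hy : y ∈ deficient J π v) : #(nbr J y \ nbr J v) ≤ 3 := by
  have h1 := hJ.one_le_of_deficient hy
  have h2 := (mem_deficient.1 hy).2.2
  have h3 := card_sdiff_add_card_inter (nbr J y) (nbr J v)
  omega

lemma PartiteSaturated.card_initialCore_le (hJ : PartiteSaturated J π)
    (hu : ∀ a ∈ weakHubs J π v, u a ∈ deficient J π v ∧ π (u a) = π a) :
    #(initialCore J π v u) ≤ #(nbr J v) + 3 * #(weakHubs J π v) := by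
  have hsub : initialCore J π v u ⊆
      nbr J v ∪ (weakHubs J π v).biUnion fun a => nbr J (u a) \ nbr J v := by
    intro y hy
    rcases mem_union.1 hy with h | h
    · exact mem_union_left _ h
    · obtain ⟨a, ha, hya⟩ := mem_biUnion.1 (mem_sdiff.1 h).1
      by_cases hyD : y ∈ nbr J v
      · exact mem_union_left _ hyD
      · exact mem_union_right _ (mem_biUnion.2 ⟨a, ha, mem_sdiff.2 ⟨hya, hyD⟩⟩)
  refine (card_le_card hsub).trans ((card_union_le _ _).trans (Nat.add_le_add_left ?_ _))
  refine card_biUnion_le.trans ((sum_le_card_nsmul _ _ 3 fun b hb => ?_).trans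
    (by rw [smul_eq_mul, mul_comm]))
  exact hJ.card_nbr_sdiff_of_deficient (hu b hb).1

lemma le_card_partRest (hn : ∀ i, #(univ.filter (π · = i)) = n) (a : V) :
    n ≤ #(partRest J π v a) + #(nbr J v) := by
  rw [← hn (π a)]
  refine (card_le_card (t := partRest J π v a ∪ nbr J v) fun y hy => ?_).trans (card_union_le _ _)
  by_cases h : y ∈ nbr J v
  · exact mem_union_right _ h
  · refine mem_union_left _ ?_
    simp only [mem_filter, mem_univ, true_and] at hy
    simp [partRest, hy]
    simpa using h

/-- The rest of the part of `a` is reached from `x` through the neighbours of `x` other than `a`. -/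
lemma PartiteSaturated.partRest_subset (hJ : PartiteSaturated J π) {x a : V} (ha : a ∈ nbr J v)
    (hxa : J.Adj x a) :
    partRest J π v a ⊆
      ((nbr J x).erase a).biUnion fun p => insert p (nbr J p ∩ partRest J π v a) := by
  intro w hw
  have hw' := hw
  simp only [partRest, mem_filter, mem_univ, true_and] at hw'
  have hxw : π x ≠ π w := by rw [hw'.1]; exact hJ.part_ne hxa
  have haw : ¬ J.Adj a w := fun h => hJ.part_ne h hw'.1.symm
  rw [mem_biUnion]
  by_cases h : J.Adj x w
  · have hwa : w ≠ a := by rintro rfl; exact hw'.2 ha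
    exact ⟨w, mem_erase.2 ⟨hwa, mem_nbr.2 h⟩, mem_insert_self _ _⟩
  · obtain ⟨z, h1, h2⟩ := hJ.common hxw h
    exact ⟨z, mem_erase.2 ⟨fun h => haw (h ▸ h2.symm), mem_nbr.2 h1⟩,
      mem_insert_of_mem (mem_inter.2 ⟨mem_nbr.2 h2.symm, hw⟩)⟩

/-- The neighbourhood of the chosen deficient vertex `u a` in the part of `a` meets the neighbourhood
of every deficient vertex that sees only `a` in `nbr J v`, since `a` itself misses `u a`. -/
lemma PartiteSaturated.exists_adj_of_weakHub (hJ : PartiteSaturated J π)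
    (hu : ∀ a ∈ weakHubs J π v, u a ∈ deficient J π v ∧ π (u a) = π a) {x a : V}
    (hx : x ∈ deficient J π v) (hxC : x ∉ initialCore J π v u) (hxa : nbr J x ∩ nbr J v = {a})
    (ha : a ∈ weakHubs J π v) : ∃ p ∈ nbr J (u a) \ nbr J v, J.Adj x p := by
  have hxa' : a ∈ nbr J x ∩ nbr J v := by rw [hxa]; exact mem_singleton_self _
  have hπ := (hu a ha).2
  have hne : π x ≠ π (u a) := by
    rw [hπ]; exact hJ.part_ne (mem_nbr.1 (mem_inter.1 hxa').1)
  have hnot : ¬ J.Adj x (u a) := by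
    intro h
    rcases mem_union.1 (nbr_subset_initialCore_union_givers ha (mem_nbr.2 h.symm)) with h | h
    · exact hxC h
    · exact Finset.disjoint_left.1 disjoint_deficient_givers hx h
  obtain ⟨z, h1, h2⟩ := hJ.common hne hnot
  refine ⟨z, mem_sdiff.2 ⟨mem_nbr.2 h2, fun hz => ?_⟩, h1⟩
  have : z ∈ nbr J x ∩ nbr J v := mem_inter.2 ⟨mem_nbr.2 h1, hz⟩
  rw [hxa, mem_singleton] at this
  subst this
  exact hJ.part_ne h2 hπ

/-- If `a` is not a weak hub, a deficient vertex that sees only `a` in `nbr J v` has at most three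
other neighbours, and these have to reach the whole part of `a`: one of them is a giver. -/
lemma PartiteSaturated.exists_giver (hJ : PartiteSaturated J π)
    (hn : ∀ i, #(univ.filter (π · = i)) = n) (hn24 : 24 ≤ n) (h5 : #(nbr J v) ≤ 5) {x a : V}
    (hx : x ∈ deficient J π v) (hxa : nbr J x ∩ nbr J v = {a})
    (ha : a ∉ weakHubs J π v) :
    ∃ p ∈ givers J π v, J.Adj x p ∧ 6 ≤ #(nbr J p ∩ partRest J π v a) := by
  have hxa' : a ∈ nbr J x ∩ nbr J v := by rw [hxa]; exact mem_singleton_self _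
  rw [mem_inter] at hxa'
  have hsub := hJ.partRest_subset hxa'.2 (mem_nbr.1 hxa'.1)
  have hW := le_card_partRest (J := J) (v := v) hn a
  have hx' := (mem_deficient.1 hx).2.2
  rw [hxa, card_singleton] at hx'
  have hcard : #((nbr J x).erase a) ≤ 3 := by rw [card_erase_of_mem hxa'.1]; omega
  obtain ⟨p, hp, hp6⟩ : ∃ p ∈ (nbr J x).erase a, 6 ≤ #(nbr J p ∩ partRest J π v a) := by
    by_contra! h
    have := (card_le_card hsub).trans (card_biUnion_le_card_mul _ _ 6 fun p hp =>
      (card_insert_le _ _).trans (h p hp))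
    omega
  rw [mem_erase, mem_nbr] at hp
  refine ⟨p, ?_, hp.2, hp6⟩
  have hpD : p ∉ nbr J v := fun h => hp.1 (by
    simpa [hxa] using (mem_inter.2 ⟨mem_nbr.2 hp.2, h⟩ : p ∈ nbr J x ∩ nbr J v))
  simp only [givers, mem_filter, mem_univ, true_and]
  exact ⟨hpD, a, mem_sdiff.2 ⟨hxa'.2, ha⟩, hp6⟩

/-- A deficient vertex outside the initial core has two neighbours in `nbr J v`, or one there and
another one in the initial core or among the givers. -/
lemma PartiteSaturated.inter_cases (hJ : PartiteSaturated J π)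
    (hn : ∀ i, #(univ.filter (π · = i)) = n) (hn24 : 24 ≤ n) (h5 : #(nbr J v) ≤ 5)
    (hu : ∀ a ∈ weakHubs J π v, u a ∈ deficient J π v ∧ π (u a) = π a) {x : V}
    (hx : x ∈ deficient J π v) (hxC : x ∉ initialCore J π v u) :
    2 ≤ #(nbr J x ∩ nbr J v) ∨ ∃ a ∈ nbr J x ∩ nbr J v, ∃ p ∈ nbr J x, p ∉ nbr J v ∧
      p ∈ initialCore J π v u ∪ givers J π v ∧
      ((a ∈ weakHubs J π v ∧ p ∈ nbr J (u a) \ nbr J v) ∨ (a ∉ weakHubs J π v ∧ p ∈ givers J π v ∧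
        6 ≤ #(nbr J p ∩ partRest J π v a))) := by
  have h1 := hJ.one_le_of_deficient hx
  rcases h1.lt_or_eq with h | h
  · exact Or.inl h
  right
  obtain ⟨a, hxa⟩ := card_eq_one.1 h.symm
  refine ⟨a, by simp [hxa], ?_⟩
  by_cases ha : a ∈ weakHubs J π v
  · obtain ⟨p, hp, hxp⟩ := hJ.exists_adj_of_weakHub hu hx hxC hxa ha
    exact ⟨p, mem_nbr.2 hxp, (mem_sdiff.1 hp).2,
      nbr_subset_initialCore_union_givers ha (mem_sdiff.1 hp).1, Or.inl ⟨ha, hp⟩⟩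
  · obtain ⟨p, hp, hxp, h6⟩ := hJ.exists_giver hn hn24 h5 hx hxa ha
    exact ⟨p, mem_nbr.2 hxp, (mem_filter.1 hp).2.1, mem_union_right _ hp, Or.inr ⟨ha, hp, h6⟩⟩

/-- A deficient vertex that is not compensated by the initial core and the givers has degree `3`,
and exactly one neighbour `q` outside the initial core and the givers. Its other two neighbours are
of one of three kinds, which leaves few possibilities for `q`. -/
lemma PartiteSaturated.uncompensated (hJ : PartiteSaturated J π)
    (hn : ∀ i, #(univ.filter (π · = i)) = n) (hn24 : 24 ≤ n) (h5 : #(nbr J v) ≤ 5)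
    (h3 : ∀ y, π y ≠ π v → 3 ≤ #(nbr J y))
    (hu : ∀ a ∈ weakHubs J π v, u a ∈ deficient J π v ∧ π (u a) = π a) {x : V}
    (hx : x ∈ deficient J π v) (hxC : x ∉ initialCore J π v u)
    (hbad : #(nbr J x) + #(nbr J x ∩ (initialCore J π v u ∪ givers J π v)) ≤ 5) :
    #(nbr J x) = 3 ∧ #(nbr J x ∩ (initialCore J π v u ∪ givers J π v)) = 2 ∧
      ∃ q K, nbr J x = insert q K ∧ q ∉ K ∧ q ∉ initialCore J π v u ∪ givers J π v ∧
      (K ∈ powersetCard 2 (nbr J v) ∨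
        (∃ a ∈ weakHubs J π v, ∃ p ∈ nbr J (u a) \ nbr J v, K = {a, p}) ∨
        (∃ p ∈ givers J π v, ∃ a ∈ nearlyFull J π v p, p ∉ nbr J v ∧ K = {a, p})) := by
  set S := initialCore J π v u ∪ givers J π v with hS
  have hDS : nbr J v ⊆ S := nbr_subset_initialCore.trans subset_union_left
  have hcases := hJ.inter_cases hn hn24 h5 hu hx hxC
  have hdeg := h3 x (mem_deficient.1 hx).1
  have h2 : 2 ≤ #(nbr J x ∩ S) := by
    rcases hcases with h | ⟨a, ha, p, hp, hpD, hpS, -⟩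
    · exact h.trans (card_le_card (inter_subset_inter_left hDS))
    · have hne : a ≠ p := by rintro rfl; exact hpD (mem_inter.1 ha).2
      rw [← card_pair hne]
      refine card_le_card fun y hy => ?_
      rcases mem_insert.1 hy with rfl | hy
      · exact mem_inter.2 ⟨(mem_inter.1 ha).1, hDS (mem_inter.1 ha).2⟩
      · rw [mem_singleton] at hy; subst hy; exact mem_inter.2 ⟨hp, hpS⟩
  have hsum := card_sdiff_add_card_inter (nbr J x) S
  have e3 : #(nbr J x) = 3 := by omega
  have e2 : #(nbr J x ∩ S) = 2 := by omega
  refine ⟨e3, e2, ?_⟩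
  obtain ⟨q, hq⟩ := card_eq_one.1 (show #(nbr J x \ S) = 1 by omega)
  have hqmem : q ∈ nbr J x \ S := by simp [hq]
  rw [mem_sdiff] at hqmem
  refine ⟨q, nbr J x ∩ S, ?_, fun h => hqmem.2 (mem_inter.1 h).2, hqmem.2, ?_⟩
  · rw [insert_eq, ← hq, sdiff_union_inter]
  rcases hcases with h | ⟨a, ha, p, hp, hpD, hpS, h⟩
  · left
    rw [mem_powersetCard]
    refine ⟨?_, e2⟩
    rw [← eq_of_subset_of_card_le (inter_subset_inter_left hDS) (e2.trans_le h)]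
    exact inter_subset_right
  · right
    have hne : a ≠ p := by rintro rfl; exact hpD (mem_inter.1 ha).2
    have hK : nbr J x ∩ S = {a, p} := by
      symm
      refine eq_of_subset_of_card_le (fun y hy => ?_) (by rw [e2, card_pair hne])
      rcases mem_insert.1 hy with rfl | hy
      · exact mem_inter.2 ⟨(mem_inter.1 ha).1, hDS (mem_inter.1 ha).2⟩
      · rw [mem_singleton] at hy; subst hy; exact mem_inter.2 ⟨hp, hpS⟩
    rcases h with ⟨haF, hpa⟩ | ⟨haF, hpP, h6⟩
    · exact Or.inl ⟨a, haF, p, hpa, hK⟩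
    · refine Or.inr ⟨p, hpP, a, ?_, hpD, hK⟩
      have haD := (mem_inter.1 ha).2
      have hqP : q ∉ givers J π v := fun h => hqmem.2 (mem_union_right _ h)
      have hqD : q ∉ nbr J v := fun h => hqmem.2 (hDS h)
      have hq5 : #(nbr J q ∩ partRest J π v a) ≤ 5 := by
        by_contra! hh
        exact hqP (by
          simp only [givers, mem_filter, mem_univ, true_and]
          exact ⟨hqD, a, mem_sdiff.2 ⟨haD, haF⟩, hh⟩)
      have hsub := hJ.partRest_subset (v := v) haD (mem_nbr.1 (mem_inter.1 ha).1)
      have her : (nbr J x).erase a ⊆ {p, q} := by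
        intro y hy
        rw [mem_erase] at hy
        by_cases hyS : y ∈ S
        · have : y ∈ nbr J x ∩ S := mem_inter.2 ⟨hy.2, hyS⟩
          rw [hK] at this
          simp only [mem_insert, mem_singleton] at this ⊢
          tauto
        · have : y ∈ nbr J x \ S := mem_sdiff.2 ⟨hy.2, hyS⟩
          rw [hq] at this
          simp only [mem_insert, mem_singleton] at this ⊢
          tauto
      have hW : partRest J π v a ⊆ insert p (nbr J p ∩ partRest J π v a) ∪
          insert q (nbr J q ∩ partRest J π v a) := by
        refine hsub.trans ((biUnion_subset_biUnion_of_subset_left _ her).trans ?_)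
        rw [biUnion_insert, singleton_biUnion]
      have hc := (card_le_card hW).trans (card_union_le _ _)
      have h1 := card_insert_le p (nbr J p ∩ partRest J π v a)
      have h2 := card_insert_le q (nbr J q ∩ partRest J π v a)
      simp only [nearlyFull, mem_filter, mem_sdiff]
      exact ⟨⟨haD, haF⟩, by omega⟩

end Charges

/-! ### The bound when degree two is confined to one part -/

section Total

variable {V ι : Type*} [Fintype V] [DecidableEq V] [DecidableEq ι] {J : SimpleGraph V} {π : V → ι}
  {n : ℕ} {v : V} {u : V → V}

/-- Total charge when the initial core is enlarged by a set `E` that takes care of the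
uncompensated deficient vertices. -/
lemma PartiteSaturated.le_two_mul_ncard (hn : ∀ i, #(univ.filter (π · = i)) = n)
    {E : Finset V} (hE : Disjoint (givers J π v) E)
    (hX : ∀ x ∈ deficient J π v, x ∉ initialCore J π v u →
      6 ≤ #(nbr J x) + #(nbr J x ∩ ((initialCore J π v u ∪ E) ∪ givers J π v)))
    {μ : ℤ} (hμ6 : μ ≤ 6)
    (hμ : ∀ y, π y = π v → y ∉ initialCore J π v u ∪ E → y ∉ givers J π v →
      μ ≤ #(nbr J y) + #(nbr J y ∩ (initialCore J π v u ∪ E))) :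
    6 * (Fintype.card V : ℤ) - (6 - μ) * n - 6 * #(initialCore J π v u ∪ E) +
      ∑ p ∈ givers J π v, ((#(nbr J p \ deficient J π v) : ℤ) - 6) ≤ 2 * J.edgeSet.ncard := by
  set C := initialCore J π v u ∪ E with hC
  set P := givers J π v with hPdef
  set X := deficient J π v with hXdef
  have hPC : Disjoint P C := Finset.disjoint_union_right.2 ⟨disjoint_givers_initialCore, hE⟩
  have hPCsub : P ⊆ Cᶜ := fun p hp => by simpa using Finset.disjoint_left.1 hPC hp
  have hsum := sum_charge_le (J := J) C P (X \ C) hPC sdiff_disjoint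
  have hpt : ∀ y ∈ Cᶜ, ((if π y = π v then μ else 6) +
      (if y ∈ P then (#(nbr J y \ X) : ℤ) - 6 else 0)) ≤ charge J C P (X \ C) y := by
    intro y hy
    rw [mem_compl] at hy
    by_cases hyP : y ∈ P
    · rw [if_pos hyP]
      have h1 : (#(nbr J y \ X) : ℤ) ≤ #(nbr J y \ (X \ C)) := by
        exact_mod_cast card_le_card (sdiff_subset_sdiff (le_refl _) sdiff_subset)
      have h2 := card_sdiff_le_charge (J := J) (C := C) (P := P) (Y := X \ C) (y := y)
      split_ifs <;> linarith
    · rw [if_neg hyP, add_zero]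
      have h1 := charge_of_notMem (J := J) (C := C) (Y := X \ C) hyP
      split_ifs with hπ
      · exact (hμ y hπ hy hyP).trans h1
      · by_cases hyX : y ∈ X
        · rw [charge_of_mem hyP (mem_sdiff.2 ⟨hyX, hy⟩)]
          have h2 := hX y hyX fun h => hy (mem_union_left _ h)
          have h3 : #(nbr J y ∩ (C ∪ P)) ≤ #(nbr J y ∩ C) + #(nbr J y ∩ P) := by
            rw [inter_union_distrib_left]; exact card_union_le _ _
          have : 6 ≤ #(nbr J y) + #(nbr J y ∩ C) + #(nbr J y ∩ P) := by omega
          exact_mod_cast this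
        · have hyD : y ∉ nbr J v := fun h =>
            hy (mem_union_left _ (nbr_subset_initialCore h))
          have h2 : 6 ≤ #(nbr J y) + #(nbr J y ∩ nbr J v) := by
            by_contra! h
            exact hyX (mem_deficient.2 ⟨hπ, hyD, by omega⟩)
          have h3 : #(nbr J y ∩ nbr J v) ≤ #(nbr J y ∩ C) := card_le_card
            (inter_subset_inter_left (nbr_subset_initialCore.trans subset_union_left))
          have : (6 : ℤ) ≤ #(nbr J y) + #(nbr J y ∩ C) := by exact_mod_cast h2.trans (by omega)
          linarith
  have h1 := (Finset.sum_le_sum hpt).trans hsum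
  rw [sum_add_distrib, Finset.sum_ite_mem, inter_eq_right.2 hPCsub] at h1
  have h2 : ∑ y ∈ Cᶜ, (if π y = π v then μ else 6) + ∑ y ∈ C, (if π y = π v then μ else 6) =
      6 * (Fintype.card V : ℤ) - (6 - μ) * n := by
    rw [Finset.sum_compl_add_sum]
    have : ∀ y, (if π y = π v then μ else 6) = 6 - (if π y = π v then 6 - μ else 0) := by
      intro y; split_ifs <;> ring
    rw [sum_congr rfl fun y _ => this y, sum_sub_distrib, ← sum_filter]
    simp [hn]
    ring
  have h3 : ∑ y ∈ C, (if π y = π v then μ else 6) ≤ 6 * (#C : ℤ) := by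
    rw [mul_comm, ← nsmul_eq_mul]
    exact sum_le_card_nsmul _ _ _ fun y _ => by split_ifs <;> linarith
  linarith

lemma six_le_of_giver {p : V} (hp : p ∈ givers J π v) : 6 ≤ #(nbr J p \ deficient J π v) := by
  obtain ⟨-, a, ha, h6⟩ := (mem_filter.1 hp).2
  refine h6.trans (card_le_card fun y hy => ?_)
  rw [mem_inter] at hy
  exact mem_sdiff.2 ⟨hy.1, fun h => Finset.disjoint_left.1 (disjoint_deficient_partRest ha) h hy.2⟩

/-- A vertex adjacent to almost all of a part without deficient vertices keeps enough charge to pay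
for at most five completers, of doubled cost `6` each, per element of `nearlyFull`. -/
lemma PartiteSaturated.nearlyFull_le (hJ : PartiteSaturated J π)
    (hn : ∀ i, #(univ.filter (π · = i)) = n) (hn100 : 100 ≤ n) (hD : #(nbr J v) ≤ 3)
    {p : V} (hp : p ∈ givers J π v) :
    6 + 30 * #(nearlyFull J π v p) ≤ #(nbr J p \ deficient J π v) := by
  have hsub : ∀ a ∈ nearlyFull J π v p,
      nbr J p ∩ partRest J π v a ⊆ nbr J p \ deficient J π v := by
    intro a ha y hy
    rw [mem_inter] at hy
    exact mem_sdiff.2 ⟨hy.1, fun h => Finset.disjoint_left.1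
      (disjoint_deficient_partRest (mem_filter.1 ha).1) h hy.2⟩
  have hlow : ∀ a ∈ nearlyFull J π v p, 90 ≤ #(nbr J p ∩ partRest J π v a) := by
    intro a ha
    have h1 := (mem_filter.1 ha).2
    have h2 := le_card_partRest (J := J) (v := v) hn a
    omega
  have hNsub : nearlyFull J π v p ⊆ nbr J v := (filter_subset _ _).trans sdiff_subset
  rcases (nearlyFull J π v p).eq_empty_or_nonempty with h0 | ⟨a, ha⟩
  · rw [h0, card_empty]; exact six_le_of_giver hp
  have ha1 := (hlow a ha).trans (card_le_card (hsub a ha))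
  by_cases h2 : #(nearlyFull J π v p) ≤ 2
  · omega
  -- All three neighbours of `v` occur, and they lie in at least two parts.
  have hcard := card_le_card hNsub
  have hEq : nearlyFull J π v p = nbr J v := eq_of_subset_of_card_le hNsub (by omega)
  have hav : π a ≠ π v := (hJ.part_ne (mem_nbr.1 (hNsub ha))).symm
  obtain ⟨b, hb, hab⟩ := hJ.exists_nbr_part_ne hn (by omega) hav
  rw [← hEq] at hb
  have hdisj : Disjoint (nbr J p ∩ partRest J π v a) (nbr J p ∩ partRest J π v b) := by
    rw [Finset.disjoint_left]
    intro y hy hy'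
    simp only [partRest, mem_inter, mem_filter, mem_univ, true_and] at hy hy'
    exact hab (hy'.2.1.symm.trans hy.2.1)
  have := card_le_card (union_subset (hsub a ha) (hsub b hb))
  rw [card_union_of_disjoint hdisj] at this
  have := hlow a ha
  have := hlow b hb
  omega

/-- The non-givers that complete a pair to a neighbourhood, for the three kinds of pairs that occur
at uncompensated deficient vertices. -/
noncomputable def extraCore (J : SimpleGraph V) (π : V → ι) (v : V) (u : V → V) : Finset V :=
  (((powersetCard 2 (nbr J v)).biUnion fun K => completers J K \ nbr J v) ∪
    ((weakHubs J π v).biUnion fun a => (nbr J (u a) \ nbr J v).biUnion fun p =>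
      completers J {a, p} \ nbr J v) ∪
    ((givers J π v).biUnion fun p => (nearlyFull J π v p).biUnion fun a =>
      completers J {a, p} \ nbr J v)) \ givers J π v

lemma card_biUnion_le_mul {α β : Type*} [DecidableEq β] {s : Finset α} {f : α → Finset β}
    {m c : ℕ} (hs : #s ≤ m) (hf : ∀ a ∈ s, #(f a) ≤ c) : #(s.biUnion f) ≤ m * c :=
  (card_biUnion_le_card_mul _ _ _ hf).trans (Nat.mul_le_mul_right _ hs)

lemma PartiteSaturated.card_extraCore_le (hJ : PartiteSaturated J π)
    (hu : ∀ a ∈ weakHubs J π v, u a ∈ deficient J π v ∧ π (u a) = π a) {d : ℕ}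
    (hd : #(nbr J v) = d) :
    #(extraCore J π v u) ≤ d.choose 2 * (1 + 2 * (d - 2)) +
      #(weakHubs J π v) * (3 * (1 + 2 * (d - 1))) +
      ∑ p ∈ givers J π v, #(nearlyFull J π v p) * (1 + 2 * (d - 1)) := by
  have hpair : ∀ a ∈ nbr J v, ∀ p, #(completers J {a, p} \ nbr J v) ≤ 1 + 2 * (d - 1) := by
    intro a ha p
    refine (hJ.card_completers_sdiff_le v _).trans ?_
    have : #(nbr J v \ {a, p}) ≤ #((nbr J v).erase a) := card_le_card fun y hy => by
      simp only [mem_sdiff, mem_insert, mem_singleton, not_or] at hy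
      exact mem_erase.2 ⟨hy.2.1, hy.1⟩
    rw [card_erase_of_mem ha, hd] at this
    omega
  refine (card_le_card sdiff_subset).trans ((card_union_le _ _).trans
    (add_le_add ((card_union_le _ _).trans (add_le_add ?_ ?_)) ?_))
  · refine card_biUnion_le_mul (by rw [card_powersetCard, hd]) fun K hK => ?_
    rw [mem_powersetCard] at hK
    refine (hJ.card_completers_sdiff_le v _).trans ?_
    rw [card_sdiff_of_subset hK.1, hK.2, hd]
  · refine card_biUnion_le_mul le_rfl fun a ha => ?_
    exact card_biUnion_le_mul (hJ.card_nbr_sdiff_of_deficient (hu a ha).1)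
      fun p _ => hpair a (mem_filter.1 ha).1 p
  · refine card_biUnion_le.trans (sum_le_sum fun p _ => ?_)
    refine card_biUnion_le_mul le_rfl fun a ha => hpair a ?_ p
    exact (mem_sdiff.1 (mem_filter.1 ha).1).1

/-- Once the core contains `extraCore`, no deficient vertex is left with too small a charge. -/
lemma PartiteSaturated.compensated (hJ : PartiteSaturated J π)
    (hn : ∀ i, #(univ.filter (π · = i)) = n) (hn24 : 24 ≤ n) (h5 : #(nbr J v) ≤ 5)
    (h3 : ∀ y, π y ≠ π v → 3 ≤ #(nbr J y))
    (hu : ∀ a ∈ weakHubs J π v, u a ∈ deficient J π v ∧ π (u a) = π a) {x : V}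
    (hx : x ∈ deficient J π v) (hxC : x ∉ initialCore J π v u) :
    6 ≤ #(nbr J x) +
      #(nbr J x ∩ ((initialCore J π v u ∪ extraCore J π v u) ∪ givers J π v)) := by
  have hmono : nbr J x ∩ (initialCore J π v u ∪ givers J π v) ⊆
      nbr J x ∩ ((initialCore J π v u ∪ extraCore J π v u) ∪ givers J π v) :=
    inter_subset_inter_left (union_subset_union_left subset_union_left)
  by_cases hbad : #(nbr J x) + #(nbr J x ∩ (initialCore J π v u ∪ givers J π v)) ≤ 5
  swap
  · have := card_le_card hmono
    omega
  obtain ⟨e3, e2, q, K, hxK, hqK, hqS, hK⟩ := hJ.uncompensated hn hn24 h5 h3 hu hx hxC hbad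
  rw [mem_union, not_or] at hqS
  have hqc : q ∈ completers J K \ nbr J v :=
    mem_sdiff.2 ⟨mem_completers.2 ⟨hqK, x, hxK⟩, fun h => hqS.1 (nbr_subset_initialCore h)⟩
  have hqE : q ∈ extraCore J π v u := by
    refine mem_sdiff.2 ⟨?_, hqS.2⟩
    rcases hK with hK | ⟨a, ha, p, hp, rfl⟩ | ⟨p, hp, a, ha, -, rfl⟩
    · exact mem_union_left _ (mem_union_left _ (mem_biUnion.2 ⟨K, hK, hqc⟩))
    · exact mem_union_left _ (mem_union_right _
        (mem_biUnion.2 ⟨a, ha, mem_biUnion.2 ⟨p, hp, hqc⟩⟩))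
    · exact mem_union_right _ (mem_biUnion.2 ⟨p, hp, mem_biUnion.2 ⟨a, ha, hqc⟩⟩)
  have hlt : #(nbr J x ∩ (initialCore J π v u ∪ givers J π v)) <
      #(nbr J x ∩ ((initialCore J π v u ∪ extraCore J π v u) ∪ givers J π v)) := by
    refine card_lt_card ⟨hmono, fun h => ?_⟩
    have hq := h (mem_inter.2 ⟨by rw [hxK]; exact mem_insert_self _ _,
      mem_union_left _ (mem_union_right _ hqE)⟩)
    rcases mem_union.1 (mem_inter.1 hq).2 with h | h
    · exact hqS.1 h
    · exact hqS.2 h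
  omega

/-- The estimate to which the total charge amounts: `d` is the degree of `v`, `f` the number of weak
hubs, `c` the size of the core, `S` and `R` what the givers pay for and keep. -/
lemma charge_arith {d f c S : ℕ} {n N R e : ℤ} (hn : 100 ≤ n) (h2 : 2 ≤ d) (h3 : d ≤ 3)
    (hf : f ≤ d) (hc : c ≤ d + 3 * f + (d.choose 2 * (1 + 2 * (d - 2)) +
      f * (3 * (1 + 2 * (d - 1))) + S * (1 + 2 * (d - 1)))) (hR : 30 * (S : ℤ) ≤ R)
    (h : 6 * N - (6 - (d : ℤ)) * n - 6 * c + R ≤ 2 * e)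
    (h' : f = d → 6 * N - (6 - ((d : ℤ) + 1)) * n - 6 * c + R ≤ 2 * e) :
    3 * N - 3 * n - 6 < e := by
  obtain rfl | rfl : d = 2 ∨ d = 3 := by omega
  · norm_num at hc h h'
    omega
  · have h32 : Nat.choose 3 2 = 3 := rfl
    norm_num [h32] at hc h h'
    omega

/-- If all vertices outside the part of `v` have degree at least three, then a saturated graph with
a vertex `v` of degree at most five has more edges than `graphG2`. -/
theorem PartiteSaturated.lt_ncard_of_three_le (hJ : PartiteSaturated J π) {k : ℕ}
    (hV : Fintype.card V = k * n)
    (hn : ∀ i, #(univ.filter (π · = i)) = n) (hn100 : 100 ≤ n) (h2 : 2 ≤ #(nbr J v))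
    (h5 : #(nbr J v) ≤ 5) (hmin : ∀ y, #(nbr J v) ≤ #(nbr J y))
    (h3 : ∀ y, π y ≠ π v → 3 ≤ #(nbr J y)) :
    3 * (k : ℤ) * n - 3 * n - 6 < J.edgeSet.ncard := by
  have hex : ∀ a, ∃ w, a ∈ weakHubs J π v → w ∈ deficient J π v ∧ π w = π a := by
    intro a
    by_cases ha : a ∈ weakHubs J π v
    · obtain ⟨w, hw, hwa⟩ := (mem_filter.1 ha).2
      exact ⟨w, fun _ => ⟨hw, hwa⟩⟩
    · exact ⟨a, fun h => absurd h ha⟩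
  choose u hu using hex
  have hF : #(weakHubs J π v) ≤ #(nbr J v) := card_le_card (filter_subset _ _)
  have hcore := hJ.card_initialCore_le hu
  have hVz : (Fintype.card V : ℤ) = k * n := by exact_mod_cast hV
  have hdisjE : Disjoint (givers J π v) (extraCore J π v u) := disjoint_sdiff
  have hmin' : ∀ (E : Finset V) (y : V), (#(nbr J v) : ℤ) ≤
      #(nbr J y) + #(nbr J y ∩ (initialCore J π v u ∪ E)) := fun E y => by
    have := hmin y; exact_mod_cast this.trans (Nat.le_add_right _ _)
  -- An uncompensated vertex has degree three, so there is none if `v` has degree at least four.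
  rcases le_or_gt 4 #(nbr J v) with h4 | h4
  · have hsum := PartiteSaturated.le_two_mul_ncard (J := J) (π := π) (v := v) (u := u) hn
      (E := ∅) (disjoint_empty_right _) (fun x hx hxC => by
        by_contra! h
        rw [union_empty] at h
        have := (hJ.uncompensated hn (by omega) h5 h3 hu hx hxC (by omega)).1
        have := hmin x
        omega) (μ := #(nbr J v)) (by omega) (fun y _ _ _ => hmin' _ y)
    have hnn : (0 : ℤ) ≤ ∑ p ∈ givers J π v, ((#(nbr J p \ deficient J π v) : ℤ) - 6) :=
      sum_nonneg fun p hp => by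
        have := six_le_of_giver hp
        omega
    rw [union_empty, hVz] at hsum
    generalize #(nbr J v) = d at *
    interval_cases d <;> push_cast at hsum <;> nlinarith
  · have hcard := (card_union_le (initialCore J π v u) (extraCore J π v u)).trans
      (add_le_add hcore (hJ.card_extraCore_le hu rfl))
    have hgive : ∑ p ∈ givers J π v, (30 * #(nearlyFull J π v p) : ℤ) ≤
        ∑ p ∈ givers J π v, ((#(nbr J p \ deficient J π v) : ℤ) - 6) := sum_le_sum fun p hp => by
      have := hJ.nearlyFull_le hn hn100 (by omega) hp
      omega
    have hsum : ∀ μ : ℤ, μ ≤ 6 → _ → _ := fun μ h6 hμ =>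
      PartiteSaturated.le_two_mul_ncard (J := J) (π := π) (v := v) (u := u) hn
        hdisjE (fun x hx hxC => hJ.compensated hn (by omega) h5 h3 hu hx hxC) (μ := μ) h6 hμ
    have hsum1 := hsum _ (by omega) fun y _ _ _ => hmin' _ y
    -- If every neighbour of `v` is a weak hub, then there are no givers, and the part of `v` also
    -- has edges to the core.
    have hsum2 : weakHubs J π v = nbr J v → _ := fun hFD =>
      hsum (#(nbr J v) + 1) (by omega) fun y hy hyE _ => by
        obtain ⟨a, ha⟩ : (nbr J v).Nonempty := card_pos.1 (by omega)
        rw [← hFD] at ha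
        have hya : π y ≠ π (u a) := by rw [hy]; exact ((mem_deficient.1 (hu a ha).1).1).symm
        have hP0 : givers J π v = ∅ := by
          refine eq_empty_of_forall_notMem fun p hp => ?_
          obtain ⟨-, b, hb, -⟩ := (mem_filter.1 hp).2
          rw [hFD, sdiff_self] at hb
          exact notMem_empty _ hb
        have hsub := nbr_subset_initialCore_union_givers (u := u) ha
        rw [hP0, union_empty] at hsub
        have hyC : y ∉ nbr J (u a) := fun h => hyE (mem_union_left _ (hsub h))
        obtain ⟨b, hb, hyb⟩ := hJ.exists_nbr_adj hya hyC
        have : 1 ≤ #(nbr J y ∩ (initialCore J π v u ∪ extraCore J π v u)) :=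
          card_pos.2 ⟨b, mem_inter.2 ⟨mem_nbr.2 hyb, mem_union_left _ (hsub hb)⟩⟩
        have := hmin y
        omega
    rw [hVz] at hsum1 hsum2
    rw [← mul_sum] at hgive
    rw [← sum_mul] at hcard
    have hFD : #(weakHubs J π v) = #(nbr J v) → weakHubs J π v = nbr J v := fun h =>
      eq_of_subset_of_card_le (filter_subset _ _) h.ge
    replace hsum2 := fun h => hsum2 (hFD h)
    have hR : 30 * ((∑ p ∈ givers J π v, #(nearlyFull J π v p) : ℕ) : ℤ) ≤
        ∑ p ∈ givers J π v, ((#(nbr J p \ deficient J π v) : ℤ) - 6) := by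
      rw [Nat.cast_sum]; exact hgive
    have := charge_arith (by exact_mod_cast hn100) h2 (by omega) hF hcard hR
      hsum1 hsum2
    linarith

end Total

/-! ### The shapes of the extremal graphs -/

/-- `J` looks like `graphG1` with `a` and `b` in the role of `(0, 0)` and `(1, 0)`. The two lines
are the two orientations of an edge. -/
def HasShapeG1 {V ι : Type*} (J : SimpleGraph V) (π : V → ι) (a b : V) : Prop :=
  π a ≠ π b ∧ ∀ u w, J.Adj u w ↔
    (((u = a ∨ u = b) ∧ π w ≠ π a ∧ π w ≠ π b) ∨ (π u = π a ∧ π w = π b ∧ ¬ (u = a ∧ w = b))) ∨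
    (((w = a ∨ w = b) ∧ π u ≠ π a ∧ π u ≠ π b) ∨ (π w = π a ∧ π u = π b ∧ ¬ (w = a ∧ u = b)))

/-- `J` looks like `graphG2` with `a`, `b` and `c` in the role of `(0, 0)`, `(1, 0)` and `(2, 0)`:
exactly one end of each edge is one of these three vertices. -/
def HasShapeG2 {V ι : Type*} [DecidableEq V] (J : SimpleGraph V) (π : V → ι) (a b c : V) : Prop :=
  π a ≠ π b ∧ π a ≠ π c ∧ π b ≠ π c ∧ ∀ u w, J.Adj u w ↔
    π u ≠ π w ∧ ¬ (u ∈ ({a, b, c} : Finset V) ↔ w ∈ ({a, b, c} : Finset V))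

section Sums

variable {V ι : Type*} [Fintype V] [DecidableEq V] [DecidableEq ι] {J : SimpleGraph V} {π : V → ι}
  {n : ℕ}

lemma sum_compl_ite_part (hn : ∀ i, #(univ.filter (π · = i)) = n) (C : Finset V) (T : Finset ι)
    (hC : ∀ c ∈ C, π c ∈ T) (α β : ℤ) :
    ∑ y ∈ Cᶜ, (if π y ∈ T then α else β) =
      β * (Fintype.card V - #T * n) + α * (#T * n - #C) := by
  have h1 : ∑ y ∈ Cᶜ, (if π y ∈ T then α else β) + ∑ y ∈ C, (if π y ∈ T then α else β) =
      ∑ y, (if π y ∈ T then α else β) := Finset.sum_compl_add_sum _ _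
  have h2 : ∑ y ∈ C, (if π y ∈ T then α else β) = #C * α := by
    rw [sum_congr rfl fun y hy => if_pos (hC y hy)]; simp
  have h3 : ∑ y, (if π y ∈ T then α else β) = β * Fintype.card V + (α - β) * (#T * n) := by
    have : ∀ y, (if π y ∈ T then α else β) = β + (if π y ∈ T then α - β else 0) := by
      intro y; split_ifs <;> ring
    rw [sum_congr rfl fun y _ => this y, sum_add_distrib, ← sum_filter]
    have hcard : #(univ.filter (π · ∈ T)) = #T * n := by
      have : univ.filter (π · ∈ T) = T.biUnion fun i => univ.filter (π · = i) := by
        ext y; simp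
      rw [this, card_biUnion, sum_congr rfl fun i _ => hn i, sum_const, smul_eq_mul]
      intro i _ j _ hij
      rw [Function.onFun, Finset.disjoint_left]
      intro y hy hy'
      simp only [mem_filter, mem_univ, true_and] at hy hy'
      exact hij (hy.symm.trans hy')
    rw [sum_const, sum_const, hcard, card_univ]
    simp only [nsmul_eq_mul]
    push_cast
    ring
  linarith

lemma two_mul_ncard_of_indep {C : Finset V} (hC : ∀ x ∈ C, ∀ y ∈ C, ¬ J.Adj x y) :
    ∑ y ∈ Cᶜ, ((#(nbr J y) : ℤ) + #(nbr J y ∩ C)) = 2 * J.edgeSet.ncard := by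
  have h := sum_card_nbr_compl (J := J) C
  have h0 : ∑ c ∈ C, #(nbr J c ∩ C) = 0 := sum_eq_zero fun c hc => by
    rw [card_eq_zero]
    refine eq_empty_of_forall_notMem fun y hy => ?_
    rw [mem_inter, mem_nbr] at hy
    exact hC c hc y hy.2 hy.1
  rw [h0, add_zero] at h
  exact_mod_cast h

end Sums

section Shapes

variable {V ι : Type*} {J : SimpleGraph V} {π : V → ι} {n : ℕ} {a b c : V}

lemma HasShapeG1.partiteSaturated (h : HasShapeG1 J π a b) (hz : ∃ z, π z ≠ π a ∧ π z ≠ π b) :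
    PartiteSaturated J π := by
  obtain ⟨hab, hadj⟩ := h
  refine ⟨fun {u w} h => ?_, fun {u v w} h1 h2 h3 => ?_, fun {u w} hne h => ?_⟩
  · rw [hadj] at h
    intro e
    grind
  · rw [hadj] at h1 h2 h3
    grind
  · obtain ⟨z, hz1, hz2⟩ := hz
    by_cases hu : π u ≠ π a ∧ π u ≠ π b
    · by_cases hw : π w = π a
      · refine ⟨b, ?_⟩; simp only [hadj] at h ⊢; grind
      · refine ⟨a, ?_⟩; simp only [hadj] at h ⊢; grind
    · by_cases hw : π w ≠ π a ∧ π w ≠ π b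
      · by_cases hu : π u = π a
        · refine ⟨b, ?_⟩; simp only [hadj] at h ⊢; grind
        · refine ⟨a, ?_⟩; simp only [hadj] at h ⊢; grind
      · refine ⟨z, ?_⟩; simp only [hadj] at h ⊢; grind

lemma HasShapeG2.partiteSaturated [DecidableEq V] (h : HasShapeG2 J π a b c)
    (hsize : ∀ x, ∃ y, y ≠ x ∧ π y = π x) : PartiteSaturated J π := by
  obtain ⟨hab, hac, hbc, hadj⟩ := h
  have key : ∀ u w, π u ≠ π w → (u ∈ ({a, b, c} : Finset V) ↔ w ∈ ({a, b, c} : Finset V)) →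
      ∃ z, (π u ≠ π z ∧ π w ≠ π z) ∧ ¬ (z ∈ ({a, b, c} : Finset V) ↔ w ∈ ({a, b, c} : Finset V)) := by
    intro u w hne hiff
    by_cases hw : w ∈ ({a, b, c} : Finset V)
    · have hu := hiff.2 hw
      obtain ⟨x, hx, hxu, hxw⟩ : ∃ x ∈ ({a, b, c} : Finset V), π u ≠ π x ∧ π w ≠ π x := by
        simp only [mem_insert, mem_singleton] at hu hw ⊢
        grind
      obtain ⟨y, hyx, hy⟩ := hsize x
      refine ⟨y, by rw [hy]; exact ⟨hxu, hxw⟩, fun hiff => ?_⟩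
      have := hiff.2 hw
      simp only [mem_insert, mem_singleton] at this hx
      grind
    · obtain ⟨x, hx, hxu, hxw⟩ : ∃ x ∈ ({a, b, c} : Finset V), π u ≠ π x ∧ π w ≠ π x := by
        simp only [mem_insert, mem_singleton]
        by_cases h1 : π u ≠ π a ∧ π w ≠ π a
        · exact ⟨a, Or.inl rfl, h1⟩
        · by_cases h2 : π u ≠ π b ∧ π w ≠ π b
          · exact ⟨b, Or.inr (Or.inl rfl), h2⟩
          · exact ⟨c, Or.inr (Or.inr rfl), by grind⟩
      exact ⟨x, ⟨hxu, hxw⟩, fun h => hw (h.1 hx)⟩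
  refine ⟨fun {u w} h => ((hadj _ _).1 h).1, fun {u v w} h1 h2 h3 => ?_, fun {u w} hne h => ?_⟩
  · rw [hadj] at h1 h2 h3
    tauto
  · rw [hadj] at h
    obtain ⟨z, hz, hz'⟩ := key u w hne (by tauto)
    refine ⟨z, ?_, ?_⟩ <;> rw [hadj] <;> tauto

variable [Fintype V] [DecidableEq V] [DecidableEq ι]

lemma HasShapeG1.two_mul_ncard (h : HasShapeG1 J π a b) (hn : ∀ i, #(univ.filter (π · = i)) = n) :
    2 * (J.edgeSet.ncard : ℤ) = 4 * (Fintype.card V - 2 * n) + (n + 1) * (2 * n - 2) := by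
  obtain ⟨hab, hadj⟩ := h
  have hne : a ≠ b := fun h => hab (h ▸ rfl)
  have hC : ∀ x ∈ ({a, b} : Finset V), ∀ y ∈ ({a, b} : Finset V), ¬ J.Adj x y := by
    intro x hx y hy
    rw [hadj]
    simp only [mem_insert, mem_singleton] at hx hy
    grind
  have hT : #({π a, π b} : Finset ι) = 2 := card_pair hab
  have hc2 : #({a, b} : Finset V) = 2 := card_pair hne
  rw [← two_mul_ncard_of_indep hC, sum_congr rfl (g := fun y =>
    if π y ∈ ({π a, π b} : Finset ι) then (n + 1 : ℤ) else 4),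
    sum_compl_ite_part hn _ _ (by simp), hT, hc2]
  · push_cast; ring
  · intro y hy
    simp only [mem_compl, mem_insert, mem_singleton, not_or] at hy
    split_ifs with hyT
    · simp only [mem_insert, mem_singleton] at hyT
      obtain ⟨x, i, hi, hx⟩ : ∃ x i, nbr J y = univ.filter (π · = i) ∧
          nbr J y ∩ {a, b} = {x} := by
        rcases hyT with e | e
        · refine ⟨b, π b, ?_, ?_⟩
          · ext w; simp only [mem_nbr, hadj, mem_filter, mem_univ, true_and]; grind
          · ext w; simp only [mem_inter, mem_nbr, hadj, mem_insert, mem_singleton]; grind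
        · refine ⟨a, π a, ?_, ?_⟩
          · ext w; simp only [mem_nbr, hadj, mem_filter, mem_univ, true_and]; grind
          · ext w; simp only [mem_inter, mem_nbr, hadj, mem_insert, mem_singleton]; grind
      rw [hx, hi, hn, card_singleton]; norm_num
    · simp only [mem_insert, mem_singleton, not_or] at hyT
      have e : nbr J y = {a, b} := by
        ext w; simp only [mem_nbr, hadj, mem_insert, mem_singleton]; grind
      rw [e, inter_self, hc2]; norm_num

lemma HasShapeG2.two_mul_ncard (h : HasShapeG2 J π a b c)
    (hn : ∀ i, #(univ.filter (π · = i)) = n) :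
    2 * (J.edgeSet.ncard : ℤ) = 6 * (Fintype.card V - 3 * n) + 4 * (3 * n - 3) := by
  obtain ⟨hab, hac, hbc, hadj⟩ := h
  have hC : ∀ x ∈ ({a, b, c} : Finset V), ∀ y ∈ ({a, b, c} : Finset V), ¬ J.Adj x y := by
    intro x hx y hy
    rw [hadj]
    tauto
  have hT : #({π a, π b, π c} : Finset ι) = 3 := card_eq_three.2 ⟨_, _, _, hab, hac, hbc, rfl⟩
  have nab : a ≠ b := fun h => hab (h ▸ rfl)
  have nac : a ≠ c := fun h => hac (h ▸ rfl)
  have nbc : b ≠ c := fun h => hbc (h ▸ rfl)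
  have hc3 : #({a, b, c} : Finset V) = 3 := card_eq_three.2 ⟨_, _, _, nab, nac, nbc, rfl⟩
  rw [← two_mul_ncard_of_indep hC, sum_congr rfl (g := fun y =>
    if π y ∈ ({π a, π b, π c} : Finset ι) then (4 : ℤ) else 6),
    sum_compl_ite_part hn _ _ (by simp), hT, hc3]
  · push_cast; ring
  · intro y hy
    rw [mem_compl] at hy
    have e : nbr J y = ({a, b, c} : Finset V).filter (π · ≠ π y) := by
      ext w; simp only [mem_nbr, hadj, mem_filter]; tauto
    have e' : nbr J y ∩ {a, b, c} = nbr J y := by rw [e]; exact inter_eq_left.2 (filter_subset _ _)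
    rw [e']
    have hcard : #(nbr J y) = if π y ∈ ({π a, π b, π c} : Finset ι) then 2 else 3 := by
      split_ifs with hyT
      · simp only [mem_insert, mem_singleton] at hyT
        rcases hyT with h | h | h
        · rw [← card_pair nbc, e]; congr 1; ext w
          simp only [mem_filter, mem_insert, mem_singleton]; grind
        · rw [← card_pair nac, e]; congr 1; ext w
          simp only [mem_filter, mem_insert, mem_singleton]; grind
        · rw [← card_pair nab, e]; congr 1; ext w
          simp only [mem_filter, mem_insert, mem_singleton]; grind
      · rw [← hc3, e]; congr 1; ext w
        simp only [mem_filter, mem_insert, mem_singleton] at hyT ⊢; grind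
    rw [hcard]
    split_ifs <;> norm_num

end Shapes

/-! ### Vertices of degree two -/

section Hubs

variable {V ι : Type*} [Fintype V] [DecidableEq V] {J : SimpleGraph V} {π : V → ι} {v a b : V}

lemma PartiteSaturated.dominated (hJ : PartiteSaturated J π) (hv : nbr J v = {a, b}) {y : V}
    (hy : π y ≠ π v) (hya : y ≠ a) (hyb : y ≠ b) : J.Adj y a ∨ J.Adj y b := by
  obtain ⟨z, hz, hyz⟩ := hJ.exists_nbr_adj hy (by rw [hv]; simp [hya, hyb])
  rw [hv, mem_insert, mem_singleton] at hz
  rcases hz with rfl | rfl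
  · exact Or.inl hyz
  · exact Or.inr hyz

lemma adj_of_nbr_eq_pair (hv : nbr J v = {a, b}) : J.Adj v a ∧ J.Adj v b := by
  constructor <;> rw [← mem_nbr, hv] <;> simp

lemma PartiteSaturated.not_adj_hubs (hJ : PartiteSaturated J π) (hv : nbr J v = {a, b}) :
    ¬ J.Adj a b := fun h =>
  hJ.no_triangle (adj_of_nbr_eq_pair hv).1 h (adj_of_nbr_eq_pair hv).2

/-- A missing edge between `N(a) \ N(b)` and `N(b) \ N(a)` is made up for by a vertex adjacent to
neither `a` nor `b`. -/
lemma PartiteSaturated.exists_common_off_hubs {V ι : Type*} {J : SimpleGraph V}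
    {π : V → ι} {a b : V} (hJ : PartiteSaturated J π)
    {x y : V} (hxa : J.Adj x a) (hyb : J.Adj y b)
    (hne : π x ≠ π y) (hxy : ¬ J.Adj x y) :
    ∃ o, J.Adj x o ∧ J.Adj y o ∧ ¬ J.Adj o a ∧ ¬ J.Adj o b := by
  obtain ⟨o, h1, h2⟩ := hJ.common hne hxy
  exact ⟨o, h1, h2, fun h => hJ.no_triangle h1 h hxa, fun h => hJ.no_triangle h2 h hyb⟩

end Hubs

section DegreeTwo

variable {V ι : Type*} [Fintype V] [DecidableEq V] [DecidableEq ι] {J : SimpleGraph V} {π : V → ι}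
  {n : ℕ} {v a b c : V}

lemma PartiteSaturated.hubs_part_ne (hJ : PartiteSaturated J π)
    (hn : ∀ i, #(univ.filter (π · = i)) = n) (hn3 : 3 ≤ n) (hv : nbr J v = {a, b}) :
    π a ≠ π b := by
  have h2 : #(nbr J v) ≤ 2 := by rw [hv]; exact card_le_two
  obtain ⟨x, hx, hxa⟩ := hJ.exists_nbr_part_ne hn (by omega)
    (hJ.part_ne (adj_of_nbr_eq_pair hv).1).symm
  rw [hv, mem_insert, mem_singleton] at hx
  rcases hx with rfl | rfl
  · exact absurd rfl hxa
  · exact hxa.symm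

/-! ### Neighbourhoods of degree two that dominate the graph -/

lemma PartiteSaturated.part_subset_nbr (hJ : PartiteSaturated J π)
    (hn : ∀ i, #(univ.filter (π · = i)) = n) (hn3 : 3 ≤ n) (hv : nbr J v = {a, b})
    (hO : ∀ y, y ≠ a → y ≠ b → J.Adj y a ∨ J.Adj y b) {y : V} (hya : J.Adj y a)
    (hyb : ¬ J.Adj y b) : univ.filter (π · = π a) ⊆ nbr J y := by
  have hab := hJ.hubs_part_ne hn hn3 hv
  have hnab := hJ.not_adj_hubs hv
  intro w hw
  simp only [mem_filter, mem_univ, true_and] at hw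
  rw [mem_nbr]
  by_cases hwa : w = a
  · rwa [hwa]
  have hwa' : ¬ J.Adj w a := fun h => hJ.part_ne h hw
  have hwb : J.Adj w b := (hO w hwa (by rintro rfl; exact hab hw.symm)).resolve_left hwa'
  by_contra hyw
  obtain ⟨o, h1, h2, h3, h4⟩ := hJ.exists_common_off_hubs hya hwb
    (by rw [hw]; exact hJ.part_ne hya) hyw
  rcases hO o (by rintro rfl; exact hwa' h2) (by rintro rfl; exact hyb h1) with h | h
  · exact h3 h
  · exact h4 h

lemma PartiteSaturated.card_nbr_of_one_hub (hJ : PartiteSaturated J π)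
    (hn : ∀ i, #(univ.filter (π · = i)) = n) (hn3 : 3 ≤ n) (hv : nbr J v = {a, b})
    (hO : ∀ y, y ≠ a → y ≠ b → J.Adj y a ∨ J.Adj y b) {y : V} (hya : J.Adj y a)
    (hyb : ¬ J.Adj y b) : n + 1 ≤ #(nbr J y) + #(nbr J y ∩ {a, b}) := by
  have h1 := card_le_card (hJ.part_subset_nbr hn hn3 hv hO hya hyb)
  rw [hn] at h1
  have h2 : 1 ≤ #(nbr J y ∩ {a, b}) := card_pos.2 ⟨a, by simp [hya]⟩
  omega

/-- With core `{a, b}`, a vertex adjacent to both hubs has doubled charge at least `4`, and a vertex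
adjacent to one hub is joined to the whole part of that hub and has doubled charge at least `n + 1`.
The vertices in the parts of the hubs are always of the second kind. -/
theorem PartiteSaturated.ncard_of_dominated (hJ : PartiteSaturated J π)
    (hn : ∀ i, #(univ.filter (π · = i)) = n) (hn4 : 4 ≤ n) (hv : nbr J v = {a, b})
    (hO : ∀ y, y ≠ a → y ≠ b → J.Adj y a ∨ J.Adj y b) :
    4 * ((Fintype.card V : ℤ) - 2 * n) + (n + 1) * (2 * n - 2) ≤ 2 * J.edgeSet.ncard ∧
      (2 * (J.edgeSet.ncard : ℤ) = 4 * ((Fintype.card V : ℤ) - 2 * n) + (n + 1) * (2 * n - 2) →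
        HasShapeG1 J π a b) := by
  have hab := hJ.hubs_part_ne hn (by omega) hv
  have hnab := hJ.not_adj_hubs hv
  have hne : a ≠ b := fun h => hab (h ▸ rfl)
  have hv' : nbr J v = {b, a} := by rw [hv, pair_comm]
  have hO' : ∀ y, y ≠ b → y ≠ a → J.Adj y b ∨ J.Adj y a := fun y h1 h2 => (hO y h2 h1).symm
  have hC : ∀ x ∈ ({a, b} : Finset V), ∀ y ∈ ({a, b} : Finset V), ¬ J.Adj x y := by
    intro x hx y hy h
    simp only [mem_insert, mem_singleton] at hx hy
    rcases hx with rfl | rfl <;> rcases hy with rfl | rfl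
    exacts [h.ne rfl, hnab h, hnab h.symm, h.ne rfl]
  have hT : #({π a, π b} : Finset ι) = 2 := card_pair hab
  have hc2 : #({a, b} : Finset V) = 2 := card_pair hne
  have hone : ∀ y, y ≠ a → y ≠ b → ¬ (J.Adj y a ∧ J.Adj y b) →
      n + 1 ≤ #(nbr J y) + #(nbr J y ∩ {a, b}) := by
    intro y hya hyb h
    rcases hO y hya hyb with h1 | h1
    · exact hJ.card_nbr_of_one_hub hn (by omega) hv hO h1 fun h2 => h ⟨h1, h2⟩
    · rw [pair_comm]
      exact hJ.card_nbr_of_one_hub hn (by omega) hv' hO' h1 fun h2 => h ⟨h2, h1⟩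
  have hboth : ∀ y, J.Adj y a → J.Adj y b → nbr J y ∩ {a, b} = {a, b} := by
    intro y h1 h2
    rw [inter_eq_right]
    intro w hw
    simp only [mem_insert, mem_singleton] at hw
    rcases hw with rfl | rfl <;> simpa
  have hsum : ∑ y ∈ ({a, b} : Finset V)ᶜ, (if π y ∈ ({π a, π b} : Finset ι) then (n + 1 : ℤ) else 4)
      = 4 * ((Fintype.card V : ℤ) - 2 * n) + (n + 1) * (2 * n - 2) := by
    rw [sum_compl_ite_part hn _ _ (by simp), hT, hc2]; push_cast; ring
  have hpt : ∀ y ∈ ({a, b} : Finset V)ᶜ,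
      (if π y ∈ ({π a, π b} : Finset ι) then (n + 1 : ℤ) else 4) ≤
        (#(nbr J y) : ℤ) + #(nbr J y ∩ {a, b}) := by
    intro y hy
    simp only [mem_compl, mem_insert, mem_singleton, not_or] at hy
    by_cases h : J.Adj y a ∧ J.Adj y b
    · rw [if_neg, hboth y h.1 h.2, hc2]
      · have : #({a, b} : Finset V) ≤ #(nbr J y) := by
          rw [← hboth y h.1 h.2]; exact card_le_card inter_subset_left
        omega
      · simp only [mem_insert, mem_singleton, not_or]
        exact ⟨hJ.part_ne h.1, hJ.part_ne h.2⟩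
    · have := hone y hy.1 hy.2 h
      split_ifs <;> omega
  rw [← two_mul_ncard_of_indep hC, ← hsum]
  refine ⟨sum_le_sum hpt, fun heq => ⟨hab, ?_⟩⟩
  have hpteq := (sum_eq_sum_iff_of_le hpt).1 heq.symm
  have hout : ∀ y, π y ≠ π a → π y ≠ π b → nbr J y = {a, b} := by
    intro y h1 h2
    have hya : y ≠ a := by rintro rfl; exact h1 rfl
    have hyb : y ≠ b := by rintro rfl; exact h2 rfl
    have e := hpteq y (by simp [hya, hyb])
    rw [if_neg (by simp [h1, h2])] at e
    by_cases h : J.Adj y a ∧ J.Adj y b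
    · rw [hboth y h.1 h.2, hc2] at e
      have e' := hboth y h.1 h.2
      refine (eq_of_subset_of_card_le (inter_eq_right.1 e') ?_).symm
      omega
    · have := hone y hya hyb h
      omega
  have hcross : ∀ u w, π u = π a → π w = π b → ¬ (u = a ∧ w = b) → J.Adj u w := by
    have half : ∀ u w, π u = π a → π w = π b → w ≠ b → J.Adj u w := by
      intro u w hu hw hwb
      have hwb' : ¬ J.Adj w b := fun h => hJ.part_ne h hw
      have hwa : J.Adj w a := (hO w (by rintro rfl; exact hab hw) hwb).resolve_right hwb'
      have := hJ.part_subset_nbr hn (by omega) hv hO hwa hwb' (show u ∈ univ.filter _ by simpa using hu)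
      exact (mem_nbr.1 this).symm
    have half' : ∀ u w, π u = π a → π w = π b → u ≠ a → J.Adj u w := by
      intro u w hu hw hua
      have hua' : ¬ J.Adj u a := fun h => hJ.part_ne h hu
      have hub : J.Adj u b := (hO u hua (by rintro rfl; exact hab hu.symm)).resolve_left hua'
      have := hJ.part_subset_nbr hn (by omega) hv' hO' hub hua' (show w ∈ univ.filter _ by simpa using hw)
      exact mem_nbr.1 this
    intro u w hu hw h
    by_cases hua : u = a
    · exact half u w hu hw fun hwb => h ⟨hua, hwb⟩
    · exact half' u w hu hw hua
  have hoA : ∀ y x, π y ≠ π a → π y ≠ π b → (J.Adj y x ↔ x = a ∨ x = b) := by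
    intro y x h1 h2
    rw [← mem_nbr, hout y h1 h2, mem_insert, mem_singleton]
  intro u w
  have hadj := hJ.part_ne (u := u) (w := w)
  by_cases hu : π u ≠ π a ∧ π u ≠ π b
  · rw [hoA u w hu.1 hu.2]; grind
  by_cases hw : π w ≠ π a ∧ π w ≠ π b
  · rw [J.adj_comm, hoA w u hw.1 hw.2]; grind
  have h1 := hcross u w
  have h2 := hcross w u
  have h3 := J.adj_comm u w
  have h4 := J.adj_comm a b
  grind

/-! ### Several vertices missed by a neighbourhood of degree two -/

/-- The second neighbour `h` of `w` would have to reach both `o₁` and `o₂`, hence be adjacent to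
`a`, and then the part of `b` could not be reached from `w`. -/
lemma PartiteSaturated.card_nbr_ne_two_of_one_hub (hJ : PartiteSaturated J π)
    (hn : ∀ i, #(univ.filter (π · = i)) = n) (hn3 : 3 ≤ n) (hv : nbr J v = {a, b})
    {o₁ o₂ : V} (ho : o₁ ≠ o₂) (h₁ : π o₁ = π v ∧ ¬ J.Adj o₁ a ∧ ¬ J.Adj o₁ b)
    (h₂ : π o₂ = π v ∧ ¬ J.Adj o₂ a ∧ ¬ J.Adj o₂ b)
    {w : V} (hw : π w ≠ π v) (hwb : J.Adj w b) (hwa : ¬ J.Adj w a) : #(nbr J w) ≠ 2 := by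
  intro hcard
  have hab := hJ.hubs_part_ne hn hn3 hv
  have hbv : π b ≠ π v := (hJ.part_ne (adj_of_nbr_eq_pair hv).2).symm
  obtain ⟨h, hh⟩ := card_eq_one.1 (show #((nbr J w).erase b) = 1 by
    rw [card_erase_of_mem (mem_nbr.2 hwb), hcard])
  have hN : ∀ z, J.Adj w z ↔ z = b ∨ z = h := by
    intro z
    rw [← mem_nbr, ← insert_erase (mem_nbr.2 hwb), hh, mem_insert, mem_singleton]
  have hhb : h ≠ b := by
    have : h ∈ (nbr J w).erase b := by simp [hh]
    exact (mem_erase.1 this).1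
  have hwh : J.Adj w h := (hN h).2 (Or.inr rfl)
  have hreach : ∀ o, π o = π v → ¬ J.Adj o b → o = h ∨ J.Adj o h := by
    intro o hov hob
    by_cases hwo : J.Adj w o
    · rcases (hN o).1 hwo with rfl | rfl
      · exact absurd hov hbv
      · exact Or.inl rfl
    · obtain ⟨z, hz1, hz2⟩ := hJ.common (by rw [hov]; exact hw) hwo
      rcases (hN z).1 hz1 with rfl | rfl
      · exact absurd hz2 hob
      · exact Or.inr hz2
  have ho₁ : J.Adj o₁ h := by
    rcases hreach o₁ h₁.1 h₁.2.2 with rfl | h'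
    · rcases hreach o₂ h₂.1 h₂.2.2 with h' | h'
      · exact absurd h'.symm ho
      · exact absurd (h₂.1.trans h₁.1.symm) (hJ.part_ne h')
    · exact h'
  have hhv : π h ≠ π v := by rw [← h₁.1]; exact (hJ.part_ne ho₁).symm
  have hha : J.Adj h a := (hJ.dominated hv hhv (by rintro rfl; exact hwa hwh) hhb).resolve_right
    fun h' => hJ.no_triangle hwh h' hwb
  obtain ⟨t, ht, htbh⟩ := exists_mem_notMem_of_card_lt_card
    (show #({b, h} : Finset V) < #(univ.filter (π · = π b)) by
      rw [hn]; exact card_le_two.trans_lt (by omega))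
  simp only [mem_filter, mem_univ, true_and, mem_insert, mem_singleton, not_or] at ht htbh
  have htb : ¬ J.Adj t b := fun h' => hJ.part_ne h' ht
  have hta : J.Adj t a := (hJ.dominated hv (by rw [ht]; exact hbv)
    (by rintro rfl; exact hab ht) htbh.1).resolve_right htb
  obtain ⟨z, hz1, hz2⟩ := hJ.common (u := w) (w := t) (by rw [ht]; exact hJ.part_ne hwb)
    fun h' => ((hN t).1 h').elim htbh.1 htbh.2
  rcases (hN z).1 hz1 with rfl | rfl
  · exact htb hz2
  · exact hJ.no_triangle hz2 hha hta

/-- If at least two vertices miss both `a` and `b`, then degree two occurs only in the part of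
`v`. -/
lemma PartiteSaturated.three_le_card_nbr (hJ : PartiteSaturated J π)
    (hn : ∀ i, #(univ.filter (π · = i)) = n) (hn4 : 4 ≤ n) (hv : nbr J v = {a, b})
    (h2 : ∀ y, 2 ≤ #(nbr J y)) {o₁ o₂ : V} (ho : o₁ ≠ o₂)
    (h₁ : π o₁ = π v ∧ ¬ J.Adj o₁ a ∧ ¬ J.Adj o₁ b) (h₂ : π o₂ = π v ∧ ¬ J.Adj o₂ a ∧ ¬ J.Adj o₂ b)
    {w : V} (hw : π w ≠ π v) : 3 ≤ #(nbr J w) := by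
  have hv' : nbr J v = {b, a} := by rw [hv, pair_comm]
  have hub : ∀ {a b : V}, nbr J v = {a, b} → 3 ≤ #(nbr J a) := by
    intro a b hv
    have hab := hJ.hubs_part_ne hn (by omega) hv
    have hsub : (univ.filter (π · = π b)).erase b ⊆ nbr J a := by
      intro t ht
      simp only [mem_erase, mem_filter, mem_univ, true_and] at ht
      rw [mem_nbr]
      refine ((hJ.dominated hv ?_ ?_ ht.1).resolve_right fun h => hJ.part_ne h ht.2).symm
      · rw [ht.2]; exact (hJ.part_ne (adj_of_nbr_eq_pair hv).2).symm
      · rintro rfl; exact hab ht.2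
    have := card_le_card hsub
    rw [card_erase_of_mem (by simp), hn] at this
    omega
  by_cases hwa : w = a
  · rw [hwa]; exact hub hv
  by_cases hwb : w = b
  · rw [hwb]; exact hub hv'
  by_contra! hlt
  have hcard : #(nbr J w) = 2 := le_antisymm (by omega) (h2 w)
  have hab := hJ.hubs_part_ne hn (by omega) hv
  by_cases h : J.Adj w a ∧ J.Adj w b
  · have hN : nbr J w = {a, b} := by
      symm
      refine eq_of_subset_of_card_le (fun y hy => ?_) ?_
      · simp only [mem_insert, mem_singleton] at hy
        rcases hy with rfl | rfl
        · simpa using h.1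
        · simpa using h.2
      · rw [hcard, card_pair fun h => hab (by rw [h])]
    rcases hJ.dominated hN (y := o₁) (by rw [h₁.1]; exact hw.symm)
      (by rintro rfl; exact hJ.part_ne (adj_of_nbr_eq_pair hv).1 h₁.1.symm)
      (by rintro rfl; exact hJ.part_ne (adj_of_nbr_eq_pair hv).2 h₁.1.symm) with h' | h'
    · exact h₁.2.1 h'
    · exact h₁.2.2 h'
  · rcases hJ.dominated hv hw hwa hwb with h' | h'
    · exact hJ.card_nbr_ne_two_of_one_hub hn (by omega) hv' ho ⟨h₁.1, h₁.2.2, h₁.2.1⟩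
        ⟨h₂.1, h₂.2.2, h₂.2.1⟩ hw h' (fun hb => h ⟨h', hb⟩) hcard
    · exact hJ.card_nbr_ne_two_of_one_hub hn (by omega) hv ho h₁ h₂ hw h' (fun ha => h ⟨ha, h'⟩)
        hcard

/-! ### A single vertex missed by a neighbourhood of degree two -/

/-- A vertex with `b` as its only neighbour among `a`, `b`, `c` is adjacent to the whole part of
`b`: a missing edge would have to be made up for by `c`. -/
lemma PartiteSaturated.part_subset_nbr_of_only (hJ : PartiteSaturated J π)
    (hn : ∀ i, #(univ.filter (π · = i)) = n) (hn3 : 3 ≤ n) (hv : nbr J v = {a, b})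
    (hO : ∀ o, π o = π v → ¬ J.Adj o a → ¬ J.Adj o b → o = c) {p : V} (hpb : J.Adj p b)
    (hpa : ¬ J.Adj p a) (hpc : ¬ J.Adj p c) : univ.filter (π · = π b) ⊆ nbr J p := by
  have hab := hJ.hubs_part_ne hn hn3 hv
  have hbv : π b ≠ π v := (hJ.part_ne (adj_of_nbr_eq_pair hv).2).symm
  have hnab := hJ.not_adj_hubs hv
  intro w hw
  simp only [mem_filter, mem_univ, true_and] at hw
  rw [mem_nbr]
  by_cases hwb : w = b
  · rwa [hwb]
  have hwb' : ¬ J.Adj w b := fun h => hJ.part_ne h hw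
  have hwa : J.Adj w a := (hJ.dominated hv (by rw [hw]; exact hbv)
    (by rintro rfl; exact hab hw) hwb).resolve_right hwb'
  by_contra hpw
  obtain ⟨o, h1, h2, h3, h4⟩ := hJ.exists_common_off_hubs hwa hpb
    (by rw [hw]; exact (hJ.part_ne hpb).symm) fun h => hpw h.symm
  have hov : π o = π v := by
    by_contra hne
    rcases hJ.dominated hv hne (by rintro rfl; exact hpa h2) (by rintro rfl; exact hwb' h1) with h | h
    · exact h3 h
    · exact h4 h
  exact hpc (hO o hov h3 h4 ▸ h2)

/-- With core `{a, b, c}`, the vertices in the three parts of the core have doubled charge at least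
`4` and the others at least `6`, with strict inequality at the givers. -/
theorem PartiteSaturated.ncard_of_unique_missed (hJ : PartiteSaturated J π)
    (hn : ∀ i, #(univ.filter (π · = i)) = n) (hn7 : 7 ≤ n) (hv : nbr J v = {a, b})
    (hcv : π c = π v) (hca : ¬ J.Adj c a) (hcb : ¬ J.Adj c b)
    (hO : ∀ o, π o = π v → ¬ J.Adj o a → ¬ J.Adj o b → o = c) :
    6 * ((Fintype.card V : ℤ) - 3 * n) + 4 * (3 * n - 3) ≤ 2 * J.edgeSet.ncard ∧
      (2 * (J.edgeSet.ncard : ℤ) = 6 * ((Fintype.card V : ℤ) - 3 * n) + 4 * (3 * n - 3) →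
        HasShapeG2 J π a b c) := by
  have hab := hJ.hubs_part_ne hn (by omega) hv
  have hav : π a ≠ π v := (hJ.part_ne (adj_of_nbr_eq_pair hv).1).symm
  have hbv : π b ≠ π v := (hJ.part_ne (adj_of_nbr_eq_pair hv).2).symm
  have hac : π a ≠ π c := by rwa [hcv]
  have hbc : π b ≠ π c := by rwa [hcv]
  have nab : a ≠ b := fun h => hab (h ▸ rfl)
  have nac : a ≠ c := fun h => hac (h ▸ rfl)
  have nbc : b ≠ c := fun h => hbc (h ▸ rfl)
  have hnab := hJ.not_adj_hubs hv
  have hv' : nbr J v = {b, a} := by rw [hv, pair_comm]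
  have hdom := fun {y} => hJ.dominated hv (y := y)
  set C : Finset V := {a, b, c} with hCdef
  set T : Finset ι := {π a, π b, π c} with hTdef
  have hT : #T = 3 := card_eq_three.2 ⟨_, _, _, hab, hac, hbc, rfl⟩
  have hC3 : #C = 3 := card_eq_three.2 ⟨_, _, _, nab, nac, nbc, rfl⟩
  have memC : ∀ y, y ∈ C ↔ y = a ∨ y = b ∨ y = c := by simp [hCdef]
  have memT : ∀ i, i ∈ T ↔ i = π a ∨ i = π b ∨ i = π c := by simp [hTdef]
  -- The receivers `Y` and the givers `P` are the vertices adjacent to exactly one of `a` and `b`: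
  -- the former also see `c` and lie off the parts of `a`, `b`, `c`; the latter do not see `c`.
  classical
  let P : Finset V := univ.filter fun p =>
    p ∉ C ∧ ¬ J.Adj p c ∧ (J.Adj p a ∧ ¬ J.Adj p b ∨ J.Adj p b ∧ ¬ J.Adj p a)
  let Y : Finset V := univ.filter fun y =>
    π y ∉ T ∧ J.Adj y c ∧ (J.Adj y a ∧ ¬ J.Adj y b ∨ J.Adj y b ∧ ¬ J.Adj y a)
  have memP : ∀ y, y ∈ P ↔ y ∉ C ∧ ¬ J.Adj y c ∧
      (J.Adj y a ∧ ¬ J.Adj y b ∨ J.Adj y b ∧ ¬ J.Adj y a) := by simp [P]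
  have memY : ∀ y, y ∈ Y ↔ π y ∉ T ∧ J.Adj y c ∧
      (J.Adj y a ∧ ¬ J.Adj y b ∨ J.Adj y b ∧ ¬ J.Adj y a) := by simp [Y]
  have hPC : Disjoint P C := Finset.disjoint_left.2 fun y hy => ((memP y).1 hy).1
  have hYC : Disjoint Y C := Finset.disjoint_left.2 fun y hy hyC => ((memY y).1 hy).1 (by
    rw [memC] at hyC; rw [memT]; rcases hyC with rfl | rfl | rfl <;> simp)
  have hsum := sum_charge_le (J := J) C P Y hPC hYC
  have hbase : ∑ y ∈ Cᶜ, (if π y ∈ T then (4 : ℤ) else 6) =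
      6 * ((Fintype.card V : ℤ) - 3 * n) + 4 * (3 * n - 3) := by
    rw [sum_compl_ite_part hn _ _ (by simp [hCdef, hTdef]), hT, hC3]; push_cast; ring
  have hgive : ∀ p ∈ P, 7 ≤ charge J C P Y p := by
    intro p hp
    refine le_trans ?_ card_sdiff_le_charge
    have half : ∀ i ∈ T, univ.filter (π · = i) ⊆ nbr J p → (7 : ℤ) ≤ #(nbr J p \ Y) := by
      intro i hi hsub
      have : univ.filter (π · = i) ⊆ nbr J p \ Y := fun w hw => mem_sdiff.2 ⟨hsub hw, fun hwY =>
        ((memY w).1 hwY).1 (by simp only [mem_filter] at hw; rw [hw.2]; exact hi)⟩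
      have := card_le_card this
      rw [hn] at this
      exact_mod_cast hn7.trans this
    obtain ⟨-, hpc, ⟨h1, h2⟩ | ⟨h1, h2⟩⟩ := (memP p).1 hp
    · exact half (π a) (by simp [memT]) (hJ.part_subset_nbr_of_only hn (by omega) hv'
        (fun o ho h3 h4 => hO o ho h4 h3) h1 h2 hpc)
    · exact half (π b) (by simp [memT])
        (hJ.part_subset_nbr_of_only hn (by omega) hv hO h1 h2 hpc)
  -- Outside the givers, the vertices of the three parts see the hubs of the other two.
  have hinT : ∀ y, y ∉ C → y ∉ P → π y ∈ T → ∀ h ∈ C, π y ≠ π h → J.Adj y h := by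
    intro y hyC hyP hyT h hhC hne
    rw [memC, not_or, not_or] at hyC
    rw [memC] at hhC
    have hP : ¬ J.Adj y c → (J.Adj y a ∧ ¬ J.Adj y b ∨ J.Adj y b ∧ ¬ J.Adj y a) → False :=
      fun h1 h2 => hyP ((memP y).2 ⟨by rw [memC]; tauto, h1, h2⟩)
    have pa := fun h => hJ.part_ne (u := y) (w := a) h
    have pb := fun h => hJ.part_ne (u := y) (w := b) h
    have pc := fun h => hJ.part_ne (u := y) (w := c) h
    have hdy := hdom (y := y)
    have hOy := hO y
    rw [memT] at hyT
    grind
  have houtc : ∀ y, π y ∉ T → J.Adj y a → J.Adj y b → J.Adj y c := by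
    intro y hyT hya hyb
    by_contra hyc
    rw [memT] at hyT
    obtain ⟨z, h1, h2⟩ := hJ.common (u := y) (w := c) (fun h => hyT (by tauto)) hyc
    have hza : ¬ J.Adj z a := fun h => hJ.no_triangle h1 h hya
    have hzb : ¬ J.Adj z b := fun h => hJ.no_triangle h1 h hyb
    rcases hdom (y := z) (by rw [← hcv]; exact (hJ.part_ne h2).symm)
      (by rintro rfl; exact hca h2) (by rintro rfl; exact hcb h2) with h | h
    · exact hza h
    · exact hzb h
  have houtY : ∀ y ∈ Y, ∃ p ∈ P, J.Adj y p := by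
    intro y hy
    obtain ⟨hyT, hyc, h⟩ := (memY y).1 hy
    rw [memT, not_or, not_or] at hyT
    rcases h with ⟨h1, h2⟩ | ⟨h1, h2⟩
    · obtain ⟨z, hz1, hz2⟩ := hJ.common hyT.2.1 h2
      refine ⟨z, (memP z).2 ⟨?_, fun h => hJ.no_triangle hz1 h hyc,
        Or.inr ⟨hz2.symm, fun h => hJ.no_triangle hz1 h h1⟩⟩, hz1⟩
      rw [memC]
      rintro (rfl | rfl | rfl)
      exacts [hnab hz2.symm, hz2.ne rfl, hcb hz2.symm]
    · obtain ⟨z, hz1, hz2⟩ := hJ.common hyT.1 h2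
      refine ⟨z, (memP z).2 ⟨?_, fun h => hJ.no_triangle hz1 h hyc,
        Or.inl ⟨hz2.symm, fun h => hJ.no_triangle hz1 h h1⟩⟩, hz1⟩
      rw [memC]
      rintro (rfl | rfl | rfl)
      exacts [hz2.ne rfl, hnab hz2, hca hz2.symm]
  have hout : ∀ y, π y ∉ T → y ∉ P → y ∉ Y → ∀ h ∈ C, J.Adj y h := by
    intro y hyT hyP hyY h hh
    rw [memP] at hyP
    rw [memY] at hyY
    have hyC : y ∉ C := fun h => hyT (by
      rw [memC] at h; rw [memT]; rcases h with rfl | rfl | rfl <;> simp)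
    have hyT' := hyT
    rw [memT] at hyT
    rw [memC] at hh
    have hd := hdom (y := y) (fun h => hyT (by rw [hcv]; tauto))
      (by rintro rfl; exact hyT (by simp)) (by rintro rfl; exact hyT (by simp))
    have hc := houtc y hyT'
    grind
  have hfilter : ∀ y, π y ∈ T → 2 ≤ #(C.filter (π y ≠ π ·)) := by
    intro y hy
    rw [memT] at hy
    obtain ⟨p, q, hpq, hpC, hqC, hp, hq⟩ : ∃ p q, p ≠ q ∧ p ∈ C ∧ q ∈ C ∧ π y ≠ π p ∧ π y ≠ π q := by
      rcases hy with h | h | h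
      · exact ⟨b, c, nbc, by simp [memC], by simp [memC], by rwa [h], by rwa [h]⟩
      · exact ⟨a, c, nac, by simp [memC], by simp [memC], by rw [h]; exact hab.symm, by rwa [h]⟩
      · exact ⟨a, b, nab, by simp [memC], by simp [memC], by rw [h]; exact hac.symm,
          by rw [h]; exact hbc.symm⟩
    rw [← card_pair hpq]
    refine card_le_card fun x hx => ?_
    simp only [mem_insert, mem_singleton] at hx
    rcases hx with rfl | rfl
    · exact mem_filter.2 ⟨hpC, hp⟩
    · exact mem_filter.2 ⟨hqC, hq⟩
  have hinT2 : ∀ y, y ∉ C → y ∉ P → π y ∈ T → 2 ≤ #(nbr J y ∩ C) := by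
    intro y hyC hyP hyT
    refine (hfilter y hyT).trans (card_le_card fun h hh => ?_)
    rw [mem_filter] at hh
    exact mem_inter.2 ⟨mem_nbr.2 (hinT y hyC hyP hyT h hh.1 hh.2), hh.1⟩
  have hout3 : ∀ y, π y ∉ T → y ∉ P → y ∉ Y → 3 ≤ #(nbr J y ∩ C) := by
    intro y hyT hyP hyY
    rw [← hC3]
    exact card_le_card fun h hh => mem_inter.2 ⟨mem_nbr.2 (hout y hyT hyP hyY h hh), hh⟩
  have hpt : ∀ y ∈ Cᶜ, (if π y ∈ T then (4 : ℤ) else 6) ≤ charge J C P Y y := by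
    intro y hy
    rw [mem_compl] at hy
    by_cases hyP : y ∈ P
    · have := hgive y hyP
      split_ifs <;> linarith
    have hle : #(nbr J y ∩ C) ≤ #(nbr J y) := card_le_card inter_subset_left
    have h1 := charge_of_notMem (J := J) (C := C) (Y := Y) hyP
    by_cases hyT : π y ∈ T
    · rw [if_pos hyT]
      have := hinT2 y hy hyP hyT
      omega
    · rw [if_neg hyT]
      by_cases hyY : y ∈ Y
      · rw [charge_of_mem hyP hyY]
        obtain ⟨p, hp, hyp⟩ := houtY y hyY
        have hp1 : 1 ≤ #(nbr J y ∩ P) := card_pos.2 ⟨p, by simp [hp, hyp]⟩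
        have hC2 : 2 ≤ #(nbr J y ∩ C) := by
          obtain ⟨-, hyc, h⟩ := (memY y).1 hyY
          have : ∃ q ∈ C, q ≠ c ∧ J.Adj y q := by
            rcases h with h | h
            · exact ⟨a, by simp [memC], nac, h.1⟩
            · exact ⟨b, by simp [memC], nbc, h.1⟩
          obtain ⟨q, hqC, hqc, hyq⟩ := this
          rw [← card_pair hqc]
          refine card_le_card fun x hx => ?_
          simp only [mem_insert, mem_singleton] at hx
          rcases hx with rfl | rfl
          · simp [hyq, hqC]
          · simp [hyc, memC]
        have hsplit : #(nbr J y ∩ P) + #(nbr J y ∩ C) ≤ #(nbr J y) := by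
          rw [← card_union_of_disjoint (disjoint_of_subset_left inter_subset_right
            (disjoint_of_subset_right inter_subset_right hPC))]
          exact card_le_card (union_subset inter_subset_left inter_subset_left)
        omega
      · have := hout3 y hyT hyP hyY
        omega
  rw [← hbase]
  refine ⟨(sum_le_sum hpt).trans hsum, fun heq => ⟨hab, hac, hbc, ?_⟩⟩
  have hpteq := (sum_eq_sum_iff_of_le hpt).1 (le_antisymm (sum_le_sum hpt) (heq ▸ hsum))
  have hP0 : ∀ p, p ∉ P := by
    intro p hp
    have h1 := hpteq p (mem_compl.2 ((memP p).1 hp).1)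
    have h2 := hgive p hp
    split_ifs at h1 <;> omega
  have hY0 : ∀ y, y ∉ Y := fun y hy => by
    obtain ⟨p, hp, -⟩ := houtY y hy
    exact hP0 p hp
  have hCadj : ∀ y, y ∉ C → ∀ h ∈ C, π y ≠ π h → J.Adj y h := fun y hy h hh hne => by
    by_cases hyT : π y ∈ T
    · exact hinT y hy (hP0 y) hyT h hh hne
    · exact hout y hyT (hP0 y) (hY0 y) h hh
  have hCsub : ∀ y, y ∉ C → nbr J y ⊆ C := by
    intro y hy
    have h1 := hpteq y (mem_compl.2 hy)
    have h2 := charge_of_notMem (J := J) (C := C) (Y := Y) (hP0 y)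
    have : #(nbr J y) ≤ #(nbr J y ∩ C) := by
      by_cases hyT : π y ∈ T
      · rw [if_pos hyT] at h1
        have := hinT2 y hy (hP0 y) hyT
        omega
      · rw [if_neg hyT] at h1
        have := hout3 y hyT (hP0 y) (hY0 y)
        omega
    rw [← eq_of_subset_of_card_le inter_subset_left this]
    exact inter_subset_right
  have hCindep : ∀ x ∈ C, ∀ y ∈ C, ¬ J.Adj x y := by
    intro x hx y hy h
    rw [memC] at hx hy
    have h' := h.symm
    have := h.ne
    have s1 := fun h : J.Adj b a => hnab h.symm
    have s2 := fun h : J.Adj a c => hca h.symm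
    have s3 := fun h : J.Adj b c => hcb h.symm
    rcases hx with rfl | rfl | rfl <;> rcases hy with rfl | rfl | rfl <;> tauto
  intro u w
  refine ⟨fun h => ⟨hJ.part_ne h, fun hiff => ?_⟩, fun ⟨hne, hiff⟩ => ?_⟩
  · by_cases hu : u ∈ C
    · exact hCindep u hu w (hiff.1 hu) h
    · exact hu (hiff.2 (hCsub u hu (mem_nbr.2 h)))
  · by_cases hu : u ∈ C
    · exact (hCadj w (fun hw => hiff (by tauto)) u hu hne.symm).symm
    · exact hCadj u hu w (by tauto) hne

end DegreeTwo

/-! ### The lower bound -/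

section LowerBound

variable {V ι : Type*} [Fintype V] [DecidableEq V] [DecidableEq ι] {J : SimpleGraph V} {π : V → ι}
  {k n : ℕ}

/-- A saturated graph has at least as many edges as `graphG1` or as `graphG2`, and in case of
equality it has the same shape. -/
theorem PartiteSaturated.dichotomy (hJ : PartiteSaturated J π)
    (hn : ∀ i, #(univ.filter (π · = i)) = n) (hn100 : 100 ≤ n) (hV : Fintype.card V = k * n)
    (hk : 3 ≤ k) (hι : ∀ i : ι, ∃ j, j ≠ i) :
    (2 * (k : ℤ) * n + (n : ℤ) ^ 2 - 4 * n - 1 ≤ J.edgeSet.ncard ∧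
      ((J.edgeSet.ncard : ℤ) = 2 * (k : ℤ) * n + (n : ℤ) ^ 2 - 4 * n - 1 →
        ∃ a b, HasShapeG1 J π a b)) ∨
    (3 * (k : ℤ) * n - 3 * n - 6 ≤ J.edgeSet.ncard ∧
      ((J.edgeSet.ncard : ℤ) = 3 * (k : ℤ) * n - 3 * n - 6 → ∃ a b c, HasShapeG2 J π a b c)) := by
  have hVz : (Fintype.card V : ℤ) = k * n := by exact_mod_cast hV
  have h2 := hJ.two_le_card_nbr hn (by omega) hι
  have hVpos : 0 < Fintype.card V := by rw [hV]; positivity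
  have : Nonempty V := Fintype.card_pos_iff.1 hVpos
  obtain ⟨v, -, hv⟩ := exists_min_image univ (fun y => #(nbr J y)) univ_nonempty
  replace hv : ∀ y, #(nbr J v) ≤ #(nbr J y) := fun y => hv y (mem_univ _)
  have hstrict : 3 * (k : ℤ) * n - 3 * n - 6 < J.edgeSet.ncard →
      (3 * (k : ℤ) * n - 3 * n - 6 ≤ J.edgeSet.ncard ∧
      ((J.edgeSet.ncard : ℤ) = 3 * (k : ℤ) * n - 3 * n - 6 → ∃ a b c, HasShapeG2 J π a b c)) :=
    fun h => ⟨h.le, fun h' => absurd h' h.ne'⟩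
  rcases le_or_gt 6 #(nbr J v) with h6 | h6
  · refine Or.inr (hstrict ?_)
    have h := sum_card_nbr (J := J)
    have h' : 6 * Fintype.card V ≤ ∑ y, #(nbr J y) := by
      have := card_nsmul_le_sum univ (fun y => #(nbr J y)) 6 fun y _ => h6.trans (hv y)
      rw [smul_eq_mul, card_univ] at this
      omega
    have h'' : 6 * (Fintype.card V : ℤ) ≤ 2 * (J.edgeSet.ncard : ℤ) := by exact_mod_cast h'.trans_eq h
    rw [hVz] at h''
    nlinarith
  rcases le_or_gt 3 #(nbr J v) with h3 | h3
  · exact Or.inr (hstrict (hJ.lt_ncard_of_three_le hV hn hn100 (by omega) (by omega) hv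
      fun y _ => h3.trans (hv y)))
  have hcard : #(nbr J v) = 2 := le_antisymm (by omega) (h2 v)
  obtain ⟨a, b, -, hab⟩ := card_eq_two.1 hcard
  by_cases hO : ∀ o, π o = π v → J.Adj o a ∨ J.Adj o b
  · left
    have hO' : ∀ y, y ≠ a → y ≠ b → J.Adj y a ∨ J.Adj y b := fun y h1 h2 => by
      by_cases h : π y = π v
      · exact hO y h
      · exact hJ.dominated hab h h1 h2
    obtain ⟨h1, h2⟩ := hJ.ncard_of_dominated hn (by omega) hab hO'
    rw [hVz] at h1 h2
    exact ⟨by nlinarith, fun h => ⟨a, b, h2 (by rw [h]; ring)⟩⟩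
  · right
    push Not at hO
    obtain ⟨c, hcv, hca, hcb⟩ := hO
    by_cases huniq : ∀ o, π o = π v → ¬ J.Adj o a → ¬ J.Adj o b → o = c
    · obtain ⟨h1, h2⟩ := hJ.ncard_of_unique_missed hn (by omega) hab hcv hca hcb huniq
      rw [hVz] at h1 h2
      exact ⟨by linarith, fun h => ⟨a, b, c, h2 (by rw [h]; ring)⟩⟩
    · push Not at huniq
      obtain ⟨o, hov, hoa, hob, hoc⟩ := huniq
      exact hstrict (hJ.lt_ncard_of_three_le hV hn hn100 (by omega) (by omega) hv fun y hy =>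
        hJ.three_le_card_nbr hn (by omega) hab h2 hoc ⟨hov, hoa, hob⟩ ⟨hcv, hca, hcb⟩ hy)

end LowerBound

/-! ### Saturation in elementary terms -/

section Translation

lemma top_fin_three_isContained_iff {V : Type*} {G : SimpleGraph V} :
    (⊤ : SimpleGraph (Fin 3)).IsContained G ↔ ∃ u v w, G.Adj u v ∧ G.Adj v w ∧ G.Adj u w := by
  classical
  have h : (⊤ : SimpleGraph (Fin 3)).IsContained G ↔ ¬ G.CliqueFree 3 :=
    (SimpleGraph.not_cliqueFree_iff_top_isContained 3).symm
  rw [h, SimpleGraph.CliqueFree]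
  push Not
  constructor
  · rintro ⟨t, ht⟩
    obtain ⟨a, b, c, h1, h2, h3, -⟩ := SimpleGraph.is3Clique_iff.1 ht
    exact ⟨a, b, c, h1, h3, h2⟩
  · rintro ⟨a, b, c, h1, h2, h3⟩
    exact ⟨{a, b, c}, SimpleGraph.is3Clique_iff.2 ⟨a, b, c, h1, h3, h2, rfl⟩⟩

lemma isSaturatedIn_iff {k n : ℕ} {J : SimpleGraph (Fin k × Fin n)} :
    IsSaturatedIn (⊤ : SimpleGraph (Fin 3)) (balancedMultipartite k n) J ↔
      PartiteSaturated J Prod.fst := by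
  constructor
  · rintro ⟨hle, hfree, hsat⟩
    have htri : ∀ {u v w}, J.Adj u v → J.Adj v w → ¬ J.Adj u w := fun {u v w} h1 h2 h3 =>
      hfree (top_fin_three_isContained_iff.2 ⟨u, v, w, h1, h2, h3⟩)
    refine ⟨fun h => SimpleGraph.completeEquipartiteGraph_adj.1 (hle h), htri,
      fun {u w} hne hadj => ?_⟩
    have h := hsat s(u, w) ⟨SimpleGraph.completeEquipartiteGraph_adj.2 hne, hadj⟩
    obtain ⟨x, y, z, hxy, hyz, hxz⟩ := top_fin_three_isContained_iff.1 h
    simp only [SimpleGraph.sup_adj, SimpleGraph.fromEdgeSet_adj, Set.mem_singleton_iff,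
      Sym2.eq_iff] at hxy hyz hxz
    have h1 := J.adj_comm x y
    have h2 := J.adj_comm y z
    have h3 := J.adj_comm x z
    have h4 := htri (u := x) (v := y) (w := z)
    by_contra hcon
    push Not at hcon
    have c1 := hcon x
    have c2 := hcon y
    have c3 := hcon z
    grind
  · intro h
    refine ⟨fun u w hadj => SimpleGraph.completeEquipartiteGraph_adj.2 (h.part_ne hadj), fun hc => ?_,
      fun e he => ?_⟩
    · obtain ⟨u, v, w, h1, h2, h3⟩ := top_fin_three_isContained_iff.1 hc
      exact h.no_triangle h1 h2 h3
    · induction e with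
      | _ u w =>
        obtain ⟨h1, h2⟩ := he
        have hne := SimpleGraph.completeEquipartiteGraph_adj.1 h1
        obtain ⟨z, hz1, hz2⟩ := h.common hne h2
        refine top_fin_three_isContained_iff.2 ⟨u, z, w, Or.inl hz1, Or.inl hz2.symm, Or.inr ?_⟩
        rw [SimpleGraph.fromEdgeSet_adj]
        exact ⟨rfl, fun h => hne (h ▸ rfl)⟩

end Translation

/-! ### Automorphisms and the extremal graphs -/

section Shapes

variable {V ι : Type*} {J J' : SimpleGraph V} {π : V → ι} {a b c : V}

/-- A bijection respecting the parts carries a graph of shape `graphG1` exactly to the graph of this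
shape with the images of the hubs as hubs. -/
lemma HasShapeG1.map_iff (h : HasShapeG1 J π a b) (φ : V ≃ V)
    (hφ : ∀ u w, π (φ u) = π (φ w) ↔ π u = π w) :
    HasShapeG1 J' π (φ a) (φ b) ↔ ∀ u w, J'.Adj (φ u) (φ w) ↔ J.Adj u w := by
  obtain ⟨hab, hadj⟩ := h
  constructor
  · rintro ⟨-, hadj'⟩ u w
    rw [hadj', hadj]
    simp only [ne_eq, hφ, φ.apply_eq_iff_eq]
  · refine fun h => ⟨fun h => hab ((hφ _ _).1 h), fun u w => ?_⟩
    obtain ⟨u, rfl⟩ := φ.surjective u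
    obtain ⟨w, rfl⟩ := φ.surjective w
    rw [h, hadj]
    simp only [ne_eq, hφ, φ.apply_eq_iff_eq]

lemma HasShapeG2.map_iff [DecidableEq V] (h : HasShapeG2 J π a b c) (φ : V ≃ V)
    (hφ : ∀ u w, π (φ u) = π (φ w) ↔ π u = π w) :
    HasShapeG2 J' π (φ a) (φ b) (φ c) ↔ ∀ u w, J'.Adj (φ u) (φ w) ↔ J.Adj u w := by
  obtain ⟨hab, hac, hbc, hadj⟩ := h
  constructor
  · rintro ⟨-, -, -, hadj'⟩ u w
    rw [hadj', hadj]
    simp only [ne_eq, hφ, φ.apply_eq_iff_eq, mem_insert, mem_singleton]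
  · refine fun h => ⟨fun h => hab ((hφ _ _).1 h), fun h => hac ((hφ _ _).1 h),
      fun h => hbc ((hφ _ _).1 h), fun u w => ?_⟩
    obtain ⟨u, rfl⟩ := φ.surjective u
    obtain ⟨w, rfl⟩ := φ.surjective w
    rw [h, hadj]
    simp only [ne_eq, hφ, φ.apply_eq_iff_eq, mem_insert, mem_singleton]

lemma fst_eq_iff_of_aut {k n : ℕ} (φ : balancedMultipartite k n ≃g balancedMultipartite k n)
    (u w : Fin k × Fin n) : (φ u).1 = (φ w).1 ↔ u.1 = w.1 := by
  have := φ.map_adj_iff (v := u) (w := w)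
  rw [SimpleGraph.completeEquipartiteGraph_adj, SimpleGraph.completeEquipartiteGraph_adj] at this
  exact not_iff_not.1 this

/-- The automorphisms of the complete multipartite graph act transitively on triples of vertices
from different parts. -/
lemma exists_aut {k n : ℕ} {x y z a b c : Fin k × Fin n} (hxy : x.1 ≠ y.1) (hxz : x.1 ≠ z.1)
    (hyz : y.1 ≠ z.1) (hab : a.1 ≠ b.1) (hac : a.1 ≠ c.1) (hbc : b.1 ≠ c.1) :
    ∃ φ : balancedMultipartite k n ≃g balancedMultipartite k n, φ x = a ∧ φ y = b ∧ φ z = c := by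
  let f : Fin k → Fin k := fun i => if i = x.1 then a.1 else if i = y.1 then b.1 else c.1
  obtain ⟨g, hg⟩ := Finset.exists_equiv_extend_of_card_eq (α := Fin k) (t := (univ : Finset (Fin k)))
    (by simp) (s := {x.1, y.1, z.1}) (f := f) (subset_univ _) (by
      intro i hi j hj hij
      simp only [coe_insert, coe_singleton, Set.mem_insert_iff, Set.mem_singleton_iff] at hi hj
      simp only [f] at hij
      grind)
  let σ : Fin k ≃ Fin k := g.trans (Equiv.subtypeUnivEquiv (fun i => mem_univ i))
  have hσx : σ x.1 = a.1 := (hg _ (by simp)).trans (by simp [f])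
  have hσy : σ y.1 = b.1 := (hg _ (by simp)).trans (by simp [f, hxy.symm])
  have hσz : σ z.1 = c.1 := (hg _ (by simp)).trans (by simp [f, hxz.symm, hyz.symm])
  let τ : Fin k → Equiv.Perm (Fin n) := fun i =>
    if i = x.1 then Equiv.swap x.2 a.2 else if i = y.1 then Equiv.swap y.2 b.2
    else Equiv.swap z.2 c.2
  let φ : Fin k × Fin n ≃ Fin k × Fin n := Equiv.prodShear σ τ
  refine ⟨⟨φ, fun {u w} => ?_⟩, ?_, ?_, ?_⟩
  · rw [SimpleGraph.completeEquipartiteGraph_adj, SimpleGraph.completeEquipartiteGraph_adj]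
    simp [φ]
  · exact Prod.ext hσx (by simp [φ, τ])
  · exact Prod.ext hσy (by simp [φ, τ, hxy.symm])
  · exact Prod.ext hσz (by simp [φ, τ, hxz.symm, hyz.symm])

variable {k n : ℕ}

lemma hasShapeG1_graphG1 (hk : 3 ≤ k) (hn : 0 < n) :
    HasShapeG1 (graphG1 k n) Prod.fst (⟨0, by omega⟩, ⟨0, hn⟩) (⟨1, by omega⟩, ⟨0, hn⟩) := by
  refine ⟨by simp, fun ⟨i, j⟩ ⟨i', j'⟩ => ?_⟩
  simp only [graphG1, SimpleGraph.fromRel_adj, Prod.mk.injEq, Fin.ext_iff, ne_eq]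
  omega

lemma hasShapeG2_graphG2 (hk : 3 ≤ k) (hn : 0 < n) :
    HasShapeG2 (graphG2 k n) Prod.fst (⟨0, by omega⟩, ⟨0, hn⟩) (⟨1, by omega⟩, ⟨0, hn⟩)
      (⟨2, by omega⟩, ⟨0, hn⟩) := by
  refine ⟨by simp, by simp, by simp, fun ⟨i, j⟩ ⟨i', j'⟩ => ?_⟩
  simp only [graphG2, SimpleGraph.fromRel_adj, Prod.mk.injEq, Fin.ext_iff, ne_eq, mem_insert,
    mem_singleton]
  omega

lemma agreeUpToAut_graphG1_iff (hk : 3 ≤ k) (hn : 0 < n) {J : SimpleGraph (Fin k × Fin n)} :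
    AgreeUpToAut (balancedMultipartite k n) (graphG1 k n) J ↔
      ∃ a b, HasShapeG1 J Prod.fst a b := by
  have hG := hasShapeG1_graphG1 (k := k) hk hn
  constructor
  · rintro ⟨φ, hφ⟩
    exact ⟨_, _, (hG.map_iff φ.toEquiv (fst_eq_iff_of_aut φ)).2 hφ⟩
  · rintro ⟨a, b, h⟩
    obtain ⟨i, hi⟩ := exists_mem_notMem_of_card_lt_card
      (show #({a.1, b.1} : Finset (Fin k)) < #(univ : Finset (Fin k)) by
        rw [card_univ, Fintype.card_fin]; exact card_le_two.trans_lt (by omega))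
    simp only [mem_insert, mem_singleton, not_or] at hi
    obtain ⟨φ, h0, h1, -⟩ := exists_aut (n := n) (x := (⟨0, by omega⟩, ⟨0, hn⟩))
      (y := (⟨1, by omega⟩, ⟨0, hn⟩)) (z := (⟨2, by omega⟩, ⟨0, hn⟩)) (by simp) (by simp) (by simp)
      h.1 (c := (i, ⟨0, hn⟩)) (Ne.symm hi.2.1) (Ne.symm hi.2.2)
    refine ⟨φ, (hG.map_iff φ.toEquiv (fst_eq_iff_of_aut φ)).1 ?_⟩
    rw [← h0, ← h1] at h
    exact h

lemma agreeUpToAut_graphG2_iff (hk : 3 ≤ k) (hn : 0 < n) {J : SimpleGraph (Fin k × Fin n)} :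
    AgreeUpToAut (balancedMultipartite k n) (graphG2 k n) J ↔
      ∃ a b c, HasShapeG2 J Prod.fst a b c := by
  have hG := hasShapeG2_graphG2 (k := k) hk hn
  constructor
  · rintro ⟨φ, hφ⟩
    exact ⟨_, _, _, (hG.map_iff φ.toEquiv (fst_eq_iff_of_aut φ)).2 hφ⟩
  · rintro ⟨a, b, c, h⟩
    obtain ⟨φ, h0, h1, h2⟩ := exists_aut (n := n) (x := (⟨0, by omega⟩, ⟨0, hn⟩))
      (y := (⟨1, by omega⟩, ⟨0, hn⟩)) (z := (⟨2, by omega⟩, ⟨0, hn⟩)) (by simp) (by simp) (by simp)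
      h.1 h.2.1 h.2.2.1
    refine ⟨φ, (hG.map_iff φ.toEquiv (fst_eq_iff_of_aut φ)).1 ?_⟩
    rw [← h0, ← h1, ← h2] at h
    exact h

lemma card_fiber_fst (i : Fin k) : #(univ.filter fun x : Fin k × Fin n => x.1 = i) = n := by
  have : (univ.filter fun x : Fin k × Fin n => x.1 = i) = {i} ×ˢ univ := by
    ext x; rw [mem_filter, mem_product, mem_singleton]; simp
  rw [this, card_product]
  simp

lemma HasShapeG1.isSaturatedIn_ncard (hk : 3 ≤ k) {J : SimpleGraph (Fin k × Fin n)}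
    {a b : Fin k × Fin n} (h : HasShapeG1 J Prod.fst a b) :
    IsSaturatedIn (⊤ : SimpleGraph (Fin 3)) (balancedMultipartite k n) J ∧
      (J.edgeSet.ncard : ℤ) = 2 * (k : ℤ) * n + (n : ℤ) ^ 2 - 4 * n - 1 := by
  obtain ⟨i, hi⟩ := exists_mem_notMem_of_card_lt_card
    (show #({a.1, b.1} : Finset (Fin k)) < #(univ : Finset (Fin k)) by
      rw [card_univ, Fintype.card_fin]; exact card_le_two.trans_lt (by omega))
  simp only [mem_insert, mem_singleton, not_or] at hi
  refine ⟨isSaturatedIn_iff.2 (h.partiteSaturated ⟨(i, a.2), hi.2⟩), ?_⟩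
  have := h.two_mul_ncard card_fiber_fst
  simp only [Fintype.card_prod, Fintype.card_fin] at this
  push_cast at this
  nlinarith

lemma HasShapeG2.isSaturatedIn_ncard (hn : 2 ≤ n) {J : SimpleGraph (Fin k × Fin n)}
    {a b c : Fin k × Fin n} (h : HasShapeG2 J Prod.fst a b c) :
    IsSaturatedIn (⊤ : SimpleGraph (Fin 3)) (balancedMultipartite k n) J ∧
      (J.edgeSet.ncard : ℤ) = 3 * (k : ℤ) * n - 3 * n - 6 := by
  refine ⟨isSaturatedIn_iff.2 (h.partiteSaturated fun x => ?_), ?_⟩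
  · have : Nontrivial (Fin n) := Fin.nontrivial_iff_two_le.2 hn
    obtain ⟨j, hj⟩ := exists_ne x.2
    exact ⟨(x.1, j), fun h => hj (congrArg Prod.snd h), rfl⟩
  · have := h.two_mul_ncard card_fiber_fst
    simp only [Fintype.card_prod, Fintype.card_fin] at this
    push_cast at this
    linarith

end Shapes

end

theorem theorem2 (k n : ℕ) (hk : 3 ≤ k) (hn : 100 ≤ n) :
    (satNumber (⊤ : SimpleGraph (Fin 3)) (balancedMultipartite k n) : ℤ) =
      min (2 * (k : ℤ) * n + (n : ℤ) ^ 2 - 4 * n - 1) (3 * (k : ℤ) * n - 3 * n - 6) ∧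
    ∀ J : SimpleGraph (Fin k × Fin n),
      (IsSaturatedIn (⊤ : SimpleGraph (Fin 3)) (balancedMultipartite k n) J ∧
        J.edgeSet.ncard =
          satNumber (⊤ : SimpleGraph (Fin 3)) (balancedMultipartite k n)) ↔
      ((2 * (k : ℤ) * n + (n : ℤ) ^ 2 - 4 * n - 1 ≤ 3 * (k : ℤ) * n - 3 * n - 6 ∧
          AgreeUpToAut (balancedMultipartite k n) (graphG1 k n) J) ∨
        (3 * (k : ℤ) * n - 3 * n - 6 ≤ 2 * (k : ℤ) * n + (n : ℤ) ^ 2 - 4 * n - 1 ∧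
          AgreeUpToAut (balancedMultipartite k n) (graphG2 k n) J)) := by
  have hdich : ∀ J : SimpleGraph (Fin k × Fin n),
      IsSaturatedIn (⊤ : SimpleGraph (Fin 3)) (balancedMultipartite k n) J → _ := fun J hJ =>
    (isSaturatedIn_iff.1 hJ).dichotomy card_fiber_fst hn (k := k) (by simp) hk fun i => by
      have : Nontrivial (Fin k) := Fin.nontrivial_iff_two_le.2 (by omega)
      exact exists_ne i
  have hG1 := (hasShapeG1_graphG1 (n := n) hk (by omega)).isSaturatedIn_ncard hk
  have hG2 := (hasShapeG2_graphG2 (n := n) hk (by omega)).isSaturatedIn_ncard (by omega)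
  have hsat : (satNumber (⊤ : SimpleGraph (Fin 3)) (balancedMultipartite k n) : ℤ) =
      min (2 * (k : ℤ) * n + (n : ℤ) ^ 2 - 4 * n - 1) (3 * (k : ℤ) * n - 3 * n - 6) := by
    apply le_antisymm
    · rw [le_min_iff, ← hG1.2, ← hG2.2]
      exact ⟨Int.ofNat_le.2 (Nat.sInf_le ⟨_, hG1.1, rfl⟩),
        Int.ofNat_le.2 (Nat.sInf_le ⟨_, hG2.1, rfl⟩)⟩
    · obtain ⟨J, hJ, hJe⟩ := Nat.sInf_mem (s := {m : ℕ | ∃ J : SimpleGraph (Fin k × Fin n),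
        IsSaturatedIn (⊤ : SimpleGraph (Fin 3)) (balancedMultipartite k n) J ∧
          J.edgeSet.ncard = m}) ⟨_, _, hG1.1, rfl⟩
      rw [satNumber, ← hJe]
      rcases hdich J hJ with h | h
      · exact (min_le_left _ _).trans h.1
      · exact (min_le_right _ _).trans h.1
  refine ⟨hsat, fun J => ⟨fun ⟨hJ, hJe⟩ => ?_, ?_⟩⟩
  · have he : (J.edgeSet.ncard : ℤ) =
        min (2 * (k : ℤ) * n + (n : ℤ) ^ 2 - 4 * n - 1) (3 * (k : ℤ) * n - 3 * n - 6) := by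
      rw [hJe, hsat]
    rcases hdich J hJ with ⟨h1, h2⟩ | ⟨h1, h2⟩
    · have hle := he ▸ min_le_left (2 * (k : ℤ) * n + (n : ℤ) ^ 2 - 4 * n - 1) _
      have hle' := he ▸ min_le_right _ (3 * (k : ℤ) * n - 3 * n - 6)
      exact Or.inl ⟨h1.trans hle', (agreeUpToAut_graphG1_iff hk (by omega)).2
        (h2 (le_antisymm hle h1))⟩
    · have hle := he ▸ min_le_left (2 * (k : ℤ) * n + (n : ℤ) ^ 2 - 4 * n - 1) _
      have hle' := he ▸ min_le_right _ (3 * (k : ℤ) * n - 3 * n - 6)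
      exact Or.inr ⟨h1.trans hle, (agreeUpToAut_graphG2_iff hk (by omega)).2
        (h2 (le_antisymm hle' h1))⟩
  · rintro (⟨hle, h⟩ | ⟨hle, h⟩)
    · obtain ⟨a, b, h⟩ := (agreeUpToAut_graphG1_iff hk (by omega)).1 h
      obtain ⟨hJ, he⟩ := h.isSaturatedIn_ncard hk
      rw [min_eq_left hle, ← he] at hsat
      exact ⟨hJ, by exact_mod_cast hsat.symm⟩
    · obtain ⟨a, b, c, h⟩ := (agreeUpToAut_graphG2_iff hk (by omega)).1 h
      obtain ⟨hJ, he⟩ := h.isSaturatedIn_ncard (by omega)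
      rw [min_eq_right hle, ← he] at hsat
      exact ⟨hJ, by exact_mod_cast hsat.symm⟩
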